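/- Let $\mathcal M=\{|\phi(\theta)\rangle\langle\phi(\theta)| : \theta\in\Theta\}$, $\Theta\subset\mathbb R^2$ open, be a two-parameter pure-state model in a complex Hilbert space $\mathcal H$ of finite or infinite dimension, where $\theta\mapsto\phi(\theta)$ is $C^1$ with $\|\phi(\theta)\|=1$. Put $$|l_i\rangle=2\bigl(\partial_i\phi-\langle\phi|\partial_i\phi\rangle\phi\bigr),\qquad J^S=\bigl[\mathrm{Re}\langle l_i|l_j\rangle\bigr],\qquad \tilde J=\bigl[\mathrm{Im}\langle l_i|l_j\rangle\bigr],$$ and assume that $|l_1\rangle,|l_2\rangle$ are linearly independent over $\mathbb R$ at every $\theta\in\Theta$, so that $J^S>0$. An estimator is a positive-operator-valued measure $M$ on $\mathbb R^2$ acting on $\mathcal H$; $E_{\theta}[M]=\int\hat\theta\,\langle\phi(\theta)|M(d\hat\theta)|\phi(\theta)\rangle$. It is locally unbiased at $\theta$ if $\int|\hat\theta|^2\langle\phi(\theta')|M(d\hat\theta)|\phi(\theta')\rangle$ is finite and bounded for $\theta'$ in a neighbourhood of $\theta$, $E_\theta[M]=\theta$ and $\partial_iE_\theta[M]^j=\delta_i^j$.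 Let $\mathcal V_\theta(\mathcal M)$ be the set of the covariance matrices $V_\theta[M]=\bigl[\int(\hat\theta^i-\theta^i)(\hat\theta^j-\theta^j)\langle\phi(\theta)|M(d\hat\theta)|\phi(\theta)\rangle\bigr]$ of all estimators $M$ that are locally unbiased at $\theta$. Fix $\theta\in\Theta$. (0) There is a real number $\beta$ such that the eigenvalues of $(J^{S})^{-1}\tilde J$ at $\theta$ are $\pm i\beta$. Every such $\beta$ satisfies $|\beta|\le1$ and (1)–(3) below. (1) For every real $2\times2$ matrix $A$ with $A^TA=J^S$ (for example $A=(J^S)^{1/2}$), that is, in the linear coordinates $\theta'=A\theta$, in which $J^S$ becomes the identity, the set $A\,\mathcal V_\theta(\mathcal M)A^T=\{AVA^T : V\in\mathcal V_\theta(\mathcal M)\}$ is exactly the set of the matrices $\begin{pmatrix}z+x&y\\y&z-x\end{pmatrix}$ with real $x,y,z$ such that, with $r=\sqrt{x^2+y^2}$, one has $z-r\ge1$ and $$|\beta|\sqrt{z+r-1}\,\sqrt{z-r-1}+\sqrt{1-\beta^2}\,\bigl(\sqrt{z+r-1}+\sqrt{z-r-1}\bigr)\ \ge\ |\beta| .$$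 (2) $\displaystyle \mathrm{CR}(J^S)=\min\{\mathrm{Tr}\,J^SV : V\in\mathcal V_\theta(\mathcal M)\}=\frac{4}{1+\sqrt{1-\beta^2}}$, and the minimum is attained. (3) Let $\mathcal M'$ be another two-parameter pure-state model, in a possibly different Hilbert space, $\theta'$ a point of its parameter domain, and $\pm i\beta'$ the eigenvalues of its matrix $(J^{S})^{-1}\tilde J$ at $\theta'$. If $|\beta|\ge|\beta'|$, then, in coordinates in which both matrices $J^S$ are the identity, $\mathcal V_\theta(\mathcal M)$ is a subset of $\mathcal V_{\theta'}(\mathcal M')$; that is, $A\,\mathcal V_\theta(\mathcal M)A^T\subseteq A'\,\mathcal V_{\theta'}(\mathcal M')A'^T$ for all real $2\times2$ matrices $A,A'$ such that $A^TA$ is the $J^S$ of $\mathcal M$ at $\theta$ and $A'^TA'$ is the $J^S$ of $\mathcal M'$ at $\theta'$. -/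

import Mathlib

open MeasureTheory Filter Topology Matrix
open scoped ENNReal NNReal InnerProductSpace

namespace PureEstimation

section Measurement

variable {H : Type*} [NormedAddCommGroup H] [InnerProductSpace ℂ H]

/-- A (generalized) measurement on `H` with outcomes in `Ω`: a normalized, countably additive
(in the strong operator topology) map from events to nonnegative Hermitian operators. -/
structure Measurement (H : Type*) [NormedAddCommGroup H] [InnerProductSpace ℂ H]
    (Ω : Type*) [MeasurableSpace Ω] where
  /-- The operator of an event. -/
  op : Set Ω → H →L[ℂ] H
  isPositive : ∀ B, MeasurableSet B → (op B).IsPositive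
  op_empty : op ∅ = 0
  op_univ : op Set.univ = 1
  hasSum_iUnion : ∀ B : ℕ → Set Ω, (∀ n, MeasurableSet (B n)) →
    Pairwise (Function.onFun Disjoint B) →
    ∀ ψ : H, HasSum (fun n => op (B n) ψ) (op (⋃ n, B n) ψ)

/-- The law `B ↦ tr(|ψ⟩⟨ψ| M(B)) = ⟨ψ, M(B) ψ⟩` of the outcome of the measurement `M`
in the vector state `ψ`. -/
noncomputable def Measurement.law {Ω : Type*} [MeasurableSpace Ω] (M : Measurement H Ω) (ψ : H) :
    Measure Ω :=
  Measure.ofMeasurable (fun B _ => ENNReal.ofReal (⟪ψ, M.op B ψ⟫_ℂ).re)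
    (by simp [M.op_empty])
    (by
      intro B hB hd
      have h1 : HasSum (fun n => (⟪ψ, M.op (B n) ψ⟫_ℂ).re) (⟪ψ, M.op (⋃ n, B n) ψ⟫_ℂ).re :=
        Complex.hasSum_re ((M.hasSum_iUnion B hB hd ψ).mapL (innerSL ℂ ψ))
      rw [← h1.tsum_eq]
      exact ENNReal.ofReal_tsum_of_nonneg
        (fun n => (M.isPositive (B n) (hB n)).re_inner_nonneg_right ψ) h1.summable)

end Measurement

section Model

variable {H : Type*} [NormedAddCommGroup H] [InnerProductSpace ℂ H] {m : ℕ}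

/-- The `i`-th partial derivative of a family of vectors. -/
noncomputable def partialDeriv (φ : (Fin m → ℝ) → H) (θ : Fin m → ℝ) (i : Fin m) : H :=
  fderiv ℝ φ θ (Pi.single i 1)

/-- The horizontal lift `|l_i⟩` of `∂/∂θ^i` at `φ(θ)`: twice the component of `∂_i φ`
orthogonal to `φ`. -/
noncomputable def horizontalLift (φ : (Fin m → ℝ) → H) (θ : Fin m → ℝ) (i : Fin m) : H :=
  (2 : ℂ) • (partialDeriv φ θ i - ⟪φ θ, partialDeriv φ θ i⟫_ℂ • φ θ)

/-- A pure state model `{|φ(θ)⟩⟨φ(θ)| : θ ∈ Θ}` with `m` non-redundant parameters, given through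
unit vectors `φ(θ)`. -/
structure PureStateModel (H : Type*) [NormedAddCommGroup H] [InnerProductSpace ℂ H]
    (m : ℕ) where
  /-- The parameter domain. -/
  Θ : Set (Fin m → ℝ)
  isOpen_Θ : IsOpen Θ
  /-- The state vectors. -/
  φ : (Fin m → ℝ) → H
  contDiffOn : ContDiffOn ℝ 1 φ Θ
  norm_eq_one : ∀ θ ∈ Θ, ‖φ θ‖ = 1
  linearIndependent : ∀ θ ∈ Θ, LinearIndependent ℝ (horizontalLift φ θ)

namespace PureStateModel

variable (𝓜 : PureStateModel H m) (θ : Fin m → ℝ)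

/-- Horizontality: `⟨l_i|φ⟩ = 0`. -/
theorem inner_horizontalLift (hθ : θ ∈ 𝓜.Θ) (i : Fin m) :
    ⟪horizontalLift 𝓜.φ θ i, 𝓜.φ θ⟫_ℂ = 0 := by
  rw [← inner_conj_symm]
  simp [horizontalLift, inner_smul_right, inner_sub_right, 𝓜.norm_eq_one θ hθ]

/-- The lift property `∂_i ρ = (|l_i⟩⟨φ| + |φ⟩⟨l_i|) / 2`, applied to a vector `w`. -/
theorem hasDerivAt_projection (hθ : θ ∈ 𝓜.Θ) (i : Fin m) (w : H) :
    HasDerivAt (fun t : ℝ => ⟪𝓜.φ (θ + t • Pi.single i 1), w⟫_ℂ • 𝓜.φ (θ + t • Pi.single i 1))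
      ((1 / 2 : ℂ) • (⟪𝓜.φ θ, w⟫_ℂ • horizontalLift 𝓜.φ θ i
        + ⟪horizontalLift 𝓜.φ θ i, w⟫_ℂ • 𝓜.φ θ)) 0 := by
  have hline : HasDerivAt (fun t : ℝ => θ + t • (Pi.single i 1 : Fin m → ℝ)) (Pi.single i 1) 0 := by
    simpa using ((hasDerivAt_id (0 : ℝ)).smul_const (Pi.single i 1 : Fin m → ℝ)).const_add θ
  have hnhds : 𝓜.Θ ∈ 𝓝 θ := 𝓜.isOpen_Θ.mem_nhds hθ
  have hd : HasFDerivAt 𝓜.φ (fderiv ℝ 𝓜.φ θ) (θ + (0 : ℝ) • (Pi.single i 1 : Fin m → ℝ)) := by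
    simpa using ((𝓜.contDiffOn.contDiffAt hnhds).differentiableAt (by simp)).hasFDerivAt
  have hφ : HasDerivAt (fun t : ℝ => 𝓜.φ (θ + t • (Pi.single i 1 : Fin m → ℝ)))
      (partialDeriv 𝓜.φ θ i) 0 := hd.comp_hasDerivAt 0 hline
  have himag : ⟪𝓜.φ θ, partialDeriv 𝓜.φ θ i⟫_ℂ + ⟪partialDeriv 𝓜.φ θ i, 𝓜.φ θ⟫_ℂ = 0 := by
    have h1 := hφ.inner ℂ hφ
    have h2 : HasDerivAt (fun t : ℝ => ⟪𝓜.φ (θ + t • (Pi.single i 1 : Fin m → ℝ)),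
        𝓜.φ (θ + t • (Pi.single i 1 : Fin m → ℝ))⟫_ℂ) 0 0 := by
      refine (hasDerivAt_const (0 : ℝ) (1 : ℂ)).congr_of_eventuallyEq ?_
      have : ∀ᶠ t : ℝ in 𝓝 0, θ + t • (Pi.single i 1 : Fin m → ℝ) ∈ 𝓜.Θ := by
        refine hline.continuousAt.eventually_mem ?_
        simpa using hnhds
      filter_upwards [this] with t ht
      rw [inner_self_eq_norm_sq_to_K, 𝓜.norm_eq_one _ ht]; simp
    simpa using h1.unique h2
  have h := (hφ.inner ℂ (hasDerivAt_const (0 : ℝ) w)).smul hφ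
  refine h.congr_deriv ?_
  simp only [zero_smul, add_zero, inner_zero_right, zero_add, horizontalLift, inner_smul_left,
    inner_sub_left, map_ofNat, inner_conj_symm]
  have h3 : ⟪partialDeriv 𝓜.φ θ i, 𝓜.φ θ⟫_ℂ = -⟪𝓜.φ θ, partialDeriv 𝓜.φ θ i⟫_ℂ :=
    eq_neg_of_add_eq_zero_right himag
  rw [h3]
  module

/-- The SLD Fisher information matrix `J^S = Re L^*L = [Re ⟨l_i|l_j⟩]`. -/
noncomputable def sldFisher : Matrix (Fin m) (Fin m) ℝ :=
  Matrix.of fun i j => (⟪horizontalLift 𝓜.φ θ i, horizontalLift 𝓜.φ θ j⟫_ℂ).re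

/-- The matrix `J̃ = Im L^*L = [Im ⟨l_i|l_j⟩]`. -/
noncomputable def imFisher : Matrix (Fin m) (Fin m) ℝ :=
  Matrix.of fun i j => (⟪horizontalLift 𝓜.φ θ i, horizontalLift 𝓜.φ θ j⟫_ℂ).im

/-- `β` is a real number such that the eigenvalues of `(J^S)⁻¹ J̃` are `± i β`. -/
def HasEigenvaluesPM (β : ℝ) : Prop :=
  spectrum ℂ (((𝓜.sldFisher θ)⁻¹ * 𝓜.imFisher θ).map (algebraMap ℝ ℂ))
    = {Complex.I * β, -(Complex.I * β)}

/-- The expectation `E_θ[M]` of an estimator, i.e. of a measurement with values in `ℝ^m`. -/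
noncomputable def mean (M : Measurement H (Fin m → ℝ)) (j : Fin m) : ℝ :=
  ∫ x, x j ∂(M.law (𝓜.φ θ))

/-- The covariance matrix `V_θ[M]` of an estimator (used for estimators with mean `θ` at `θ`). -/
noncomputable def cov (M : Measurement H (Fin m → ℝ)) : Matrix (Fin m) (Fin m) ℝ :=
  Matrix.of fun i j => ∫ x, (x i - θ i) * (x j - θ j) ∂(M.law (𝓜.φ θ))

/-- Local unbiasedness at `θ` of an estimator: `E_θ[M] = θ` and `∂_i E_θ[M]^j = δ_i^j`. The second
moment is required to be finite, and bounded, near `θ`. -/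
structure IsLocallyUnbiased (M : Measurement H (Fin m → ℝ)) : Prop where
  bounded_moment : ∃ C : ℝ≥0, ∀ᶠ θ' in 𝓝 θ, ∫⁻ x, ‖x‖ₑ ^ 2 ∂(M.law (𝓜.φ θ')) ≤ C
  mean_eq : ∀ j, 𝓜.mean θ M j = θ j
  hasDerivAt_mean : ∀ i j, HasDerivAt (fun t : ℝ => 𝓜.mean (θ + t • Pi.single i 1) M j)
    (if i = j then 1 else 0) 0

/-- The set `𝒱_θ(𝓜)` of the covariance matrices of the locally unbiased estimators. -/
def covSet : Set (Matrix (Fin m) (Fin m) ℝ) :=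
  {V | ∃ M : Measurement H (Fin m → ℝ), 𝓜.IsLocallyUnbiased θ M ∧ V = 𝓜.cov θ M}

/-- The set `𝒱_θ(𝓜)` in the coordinates `θ' = A θ`. -/
def covSetIn (A : Matrix (Fin m) (Fin m) ℝ) : Set (Matrix (Fin m) (Fin m) ℝ) :=
  (fun V => A * V * Aᵀ) '' 𝓜.covSet θ

end PureStateModel

/-- The explicit region of the matrices `[[z + x, y], [y, z - x]]`, with eigenvalues `z ± r`,
`r = (x² + y²)^{1/2}`: those with `z - r ≥ 1` on or above the surface obtained by rotating the curve
`|β| (z+x-1)^{1/2} (z-x-1)^{1/2} + (1-β²)^{1/2} ((z+x-1)^{1/2} + (z-x-1)^{1/2}) = |β|`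
around the `z`-axis. -/
def normalizedRegion (β : ℝ) : Set (Matrix (Fin 2) (Fin 2) ℝ) :=
  {V | ∃ x y z r : ℝ, V = !![z + x, y; y, z - x] ∧ r = √(x ^ 2 + y ^ 2) ∧ 1 ≤ z - r ∧
    |β| ≤ |β| * √(z + r - 1) * √(z - r - 1)
      + √(1 - β ^ 2) * (√(z + r - 1) + √(z - r - 1))}

end Model

end PureEstimation

/-! The covariance problem reduces to a problem about vectors. For a locally unbiased M, the vectors
x_j = ∫ (θ̂^j - θ^j) M(dθ̂) φ are orthogonal to φ and satisfy Re⟨l_i|x_j⟩ = δ_ij, and their Gram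
form is dominated by V (`exists_estimationVectors`). Conversely, every symmetric V dominating the
Gram form of such vectors is the covariance of a measurement with finitely many outcomes
(`mem_covSet_of_estimationVectors`).

When J^S is the identity, the lifts are unit vectors with ⟨l_0|l_1⟩ = ib, where b² = det J̃ / det
J^S = β². Put γ = √(1 - b²) and l_1 = ib l_0 + γe with e ⟂ l_0. In the plane of l_0 and e, the
constraints on x leave a free real 2×2 matrix P, and the Gram matrix becomes 1 + PPᵀ + isε with s =
γ(p₂ - p₁) + b(1 - det P). So W = V - 1 must dominate PPᵀ + isε for some P
(`isAttainable_iff_planeDominates`).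

Let d = √det W and τ = tr √W = √(tr W + 2d). A suitable P exists iff |b| ≤ |b|d + γτ
(`planeDominates_iff`). If d ≤ 1, rotating √W to P = √W R changes p₂ - p₁ without changing PPᵀ or
det P, and s = 0 can be reached; if d ≥ 1, a multiple of √W has determinant 1 and s = 0. Necessity
is a Minkowski-type bound on det W together with a bound on tr W.

The eigenvalues of W are z ± r - 1, so d and τ are the product and the sum of their square roots,
which gives the explicit region. Its least trace and its monotonicity in |β| are then elementary. -/

namespace PureEstimation

/-! ### Integrals of simple functions against an operator measure -/

section MeasurementCalculus

variable {H : Type*} [NormedAddCommGroup H] [InnerProductSpace ℂ H]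
  {Ω : Type*} [MeasurableSpace Ω]

namespace Measurement

variable (M : Measurement H Ω)

theorem op_union {s t : Set Ω} (hs : MeasurableSet s) (ht : MeasurableSet t) (hst : Disjoint s t) :
    M.op (s ∪ t) = M.op s + M.op t := by
  ext ψ
  set B : ℕ → Set Ω := fun n => if n = 0 then s else if n = 1 then t else ∅ with hB
  have hU : (⋃ n, B n) = s ∪ t := by
    ext x
    simp only [Set.mem_iUnion, Set.mem_union, hB]
    constructor
    · rintro ⟨n, hn⟩
      split_ifs at hn
      · exact Or.inl hn
      · exact Or.inr hn
      · exact hn.elim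
    · rintro (h | h)
      · exact ⟨0, by simpa using h⟩
      · exact ⟨1, by simpa using h⟩
  have hm : ∀ n, MeasurableSet (B n) := by
    intro n
    simp only [hB]
    split_ifs
    exacts [hs, ht, MeasurableSet.empty]
  have hd : Pairwise (Function.onFun Disjoint B) := by
    intro i j hij
    simp only [Function.onFun, hB]
    split_ifs <;> first | (subst_vars; exact absurd rfl hij) | simp [hst, hst.symm]
  have h := M.hasSum_iUnion B hm hd ψ
  rw [hU] at h
  have h2 : HasSum (fun n => M.op (B n) ψ) (∑ n ∈ Finset.range 2, M.op (B n) ψ) := by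
    refine hasSum_sum_of_ne_finset_zero ?_
    intro n hn
    have h0 : n ≠ 0 := by rintro rfl; simp at hn
    have h1 : n ≠ 1 := by rintro rfl; simp at hn
    simp [hB, h0, h1, M.op_empty]
  rw [h.unique h2]
  simp [Finset.sum_range_succ, hB]

theorem law_apply (ψ : H) {B : Set Ω} (hB : MeasurableSet B) :
    M.law ψ B = ENNReal.ofReal (⟪ψ, M.op B ψ⟫_ℂ).re :=
  Measure.ofMeasurable_apply B hB

theorem re_inner_op_nonneg (ψ : H) {B : Set Ω} (hB : MeasurableSet B) :
    0 ≤ (⟪ψ, M.op B ψ⟫_ℂ).re :=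
  (M.isPositive B hB).re_inner_nonneg_right ψ

theorem inner_op_eq_re (ψ : H) {B : Set Ω} (hB : MeasurableSet B) :
    ⟪ψ, M.op B ψ⟫_ℂ = ((⟪ψ, M.op B ψ⟫_ℂ).re : ℂ) := by
  have h := (M.isPositive B hB).inner_nonneg_right ψ
  exact Complex.eq_re_of_ofReal_le h

theorem law_univ (ψ : H) : M.law ψ Set.univ = ENNReal.ofReal (‖ψ‖ ^ 2) := by
  rw [M.law_apply ψ MeasurableSet.univ, M.op_univ]
  congr 1
  simpa using inner_self_eq_norm_sq (𝕜 := ℂ) ψ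

instance isFiniteMeasure_law (ψ : H) : IsFiniteMeasure (M.law ψ) :=
  ⟨by rw [M.law_univ]; exact ENNReal.ofReal_lt_top⟩

theorem law_real (ψ : H) {B : Set Ω} (hB : MeasurableSet B) :
    (M.law ψ).real B = (⟪ψ, M.op B ψ⟫_ℂ).re := by
  rw [Measure.real, M.law_apply ψ hB, ENNReal.toReal_ofReal (M.re_inner_op_nonneg ψ hB)]

theorem law_real_univ (ψ : H) : (M.law ψ).real Set.univ = ‖ψ‖ ^ 2 := by
  rw [Measure.real, M.law_univ ψ, ENNReal.toReal_ofReal (by positivity)]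

/-- Parallelogram law for the positive form of each event, with the ψ - χ term dropped. It carries
integrability and moment bounds over to sums of vectors. -/
theorem law_add_le (ψ χ : H) : M.law (ψ + χ) ≤ (2 : ℝ≥0∞) • M.law ψ + (2 : ℝ≥0∞) • M.law χ := by
  rw [Measure.le_iff]
  intro B hB
  rw [Measure.add_apply, Measure.smul_apply, Measure.smul_apply, M.law_apply _ hB,
    M.law_apply _ hB, M.law_apply _ hB, smul_eq_mul, smul_eq_mul,
    show (2 : ℝ≥0∞) = ENNReal.ofReal 2 by simp, ← ENNReal.ofReal_mul (by norm_num),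
    ← ENNReal.ofReal_mul (by norm_num), ← ENNReal.ofReal_add
      (mul_nonneg (by norm_num) (M.re_inner_op_nonneg ψ hB))
      (mul_nonneg (by norm_num) (M.re_inner_op_nonneg χ hB))]
  apply ENNReal.ofReal_le_ofReal
  have h := M.re_inner_op_nonneg (ψ - χ) hB
  simp only [map_sub, map_add, inner_sub_left, inner_sub_right, inner_add_left, inner_add_right,
    Complex.sub_re, Complex.add_re] at h ⊢
  linarith

/-- **Cauchy–Schwarz** for the operator of an event. -/
theorem norm_inner_op_le (u v : H) {B : Set Ω} (hB : MeasurableSet B) :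
    ‖⟪u, M.op B v⟫_ℂ‖ ≤ √((M.law u).real B) * √((M.law v).real B) := by
  rw [M.law_real u hB, M.law_real v hB, ← Real.sqrt_mul (M.re_inner_op_nonneg u hB)]
  apply Real.le_sqrt_of_sq_le
  set z := ⟪u, M.op B v⟫_ℂ with hz
  set a := (⟪u, M.op B u⟫_ℂ).re with ha
  set b := (⟪v, M.op B v⟫_ℂ).re with hb
  have hvu : ⟪v, M.op B u⟫_ℂ = (starRingEnd ℂ) z := by
    rw [hz, inner_conj_symm, (M.isPositive B hB).inner_left_eq_inner_right]
  have huu : ⟪u, M.op B u⟫_ℂ = (a : ℂ) := M.inner_op_eq_re u hB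
  have hvv : ⟪v, M.op B v⟫_ℂ = (b : ℂ) := M.inner_op_eq_re v hB
  clear_value a b z
  -- The factor conj z in the coefficient of v removes the phase of the cross term, leaving a real
  -- quadratic in t.
  have key : ∀ t : ℝ, 0 ≤ ‖z‖ ^ 2 * b * (t * t) + (2 * ‖z‖ ^ 2) * t + a := by
    intro t
    have h := M.re_inner_op_nonneg (u + ((t : ℂ) * (starRingEnd ℂ) z) • v) hB
    simp only [map_add, map_smul, inner_add_left, inner_add_right, inner_smul_left,
      inner_smul_right, ← hz, hvu, huu, hvv] at h
    simp only [Complex.add_re, Complex.add_im, Complex.mul_re, Complex.mul_im,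
      Complex.ofReal_re, Complex.ofReal_im, Complex.conj_re, Complex.conj_im,
      map_mul, Complex.conj_ofReal, Complex.conj_conj] at h
    have hn : ‖z‖ ^ 2 = z.re * z.re + z.im * z.im := by
      rw [← Complex.normSq_eq_norm_sq, Complex.normSq_apply]
    rw [hn]
    linarith
  have hd := discrim_le_zero key
  rw [discrim] at hd
  rcases eq_or_lt_of_le (sq_nonneg ‖z‖) with h0 | h0
  · rw [← h0]
    rw [ha, hb]
    exact mul_nonneg (M.re_inner_op_nonneg u hB) (M.re_inner_op_nonneg v hB)
  · nlinarith

/-- The integral `∫ g dM` of a simple function. -/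
noncomputable def simpleOp (g : SimpleFunc Ω ℂ) : H →L[ℂ] H :=
  ∑ y ∈ g.range, y • M.op (g ⁻¹' {y})

/-- The set function `B ↦ (c ↦ c M(B))`. -/
noncomputable def smulOp (B : Set Ω) : ℂ →L[ℝ] (H →L[ℂ] H) :=
  (ContinuousLinearMap.toSpanSingleton ℂ (M.op B)).restrictScalars ℝ

/-- Over the zero measure every event has finite measure and every function is integrable, so the
additivity calculus of `setToSimpleFunc` applies without restriction. -/
theorem finMeasAdditive_smulOp : FinMeasAdditive (0 : Measure Ω) M.smulOp := by
  intro s t hs ht _ _ hst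
  ext c : 1
  simp [smulOp, M.op_union hs ht hst, ContinuousLinearMap.toSpanSingleton]

theorem simpleOp_eq (g : SimpleFunc Ω ℂ) :
    M.simpleOp g = g.setToSimpleFunc M.smulOp := rfl

theorem simpleOp_map {G : Type*} [NormedAddCommGroup G] (p : SimpleFunc Ω G) (F : G → ℂ)
    (hF : F 0 = 0) :
    M.simpleOp (p.map F) = ∑ y ∈ p.range, F y • M.op (p ⁻¹' {y}) := by
  rw [simpleOp_eq, SimpleFunc.map_setToSimpleFunc M.smulOp M.finMeasAdditive_smulOp
    (integrable_zero_measure) hF]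
  rfl

theorem simpleOp_sub (f g : SimpleFunc Ω ℂ) :
    M.simpleOp (f - g) = M.simpleOp f - M.simpleOp g :=
  SimpleFunc.setToSimpleFunc_sub M.smulOp M.finMeasAdditive_smulOp
    integrable_zero_measure integrable_zero_measure

theorem simpleOp_const (c : ℂ) : M.simpleOp (SimpleFunc.const Ω c) = c • 1 := by
  rw [simpleOp_eq, SimpleFunc.setToSimpleFunc_const]
  · simp [smulOp, M.op_univ, ContinuousLinearMap.toSpanSingleton]
  · ext c : 1
    simp [smulOp, M.op_empty, ContinuousLinearMap.toSpanSingleton]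

theorem simpleOp_map_sum {G ι : Type*} [NormedAddCommGroup G] [Fintype ι] (p : SimpleFunc Ω G)
    (c : ι → ℂ) (F : ι → G → ℂ) (hF : ∀ i, F i 0 = 0) :
    M.simpleOp (p.map fun y => ∑ i, c i * F i y) = ∑ i, c i • M.simpleOp (p.map (F i)) := by
  rw [M.simpleOp_map p _ (by simp [hF])]
  simp only [M.simpleOp_map p _ (hF _), Finset.sum_smul, Finset.smul_sum, mul_smul]
  exact Finset.sum_comm

theorem inner_simpleOp_self (g : SimpleFunc Ω ℂ) (ψ : H) :
    ⟪ψ, M.simpleOp g ψ⟫_ℂ = ∫ x, g x ∂(M.law ψ) := by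
  rw [← SimpleFunc.integral_eq_integral g (SimpleFunc.integrable_of_isFiniteMeasure g),
    SimpleFunc.integral_eq, simpleOp]
  simp only [_root_.sum_apply, inner_sum, _root_.smul_apply,
    inner_smul_right]
  refine Finset.sum_congr rfl fun y _ => ?_
  rw [M.inner_op_eq_re ψ (g.measurableSet_fiber y), M.law_real ψ (g.measurableSet_fiber y),
    mul_comm, Complex.real_smul]

theorem inner_simpleOp_comm (g : SimpleFunc Ω ℂ) (hg : ∀ x, (starRingEnd ℂ) (g x) = g x) (u v : H) :
    ⟪M.simpleOp g u, v⟫_ℂ = ⟪u, M.simpleOp g v⟫_ℂ := by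
  simp only [simpleOp, _root_.sum_apply, inner_sum, sum_inner,
    _root_.smul_apply, inner_smul_right, inner_smul_left]
  refine Finset.sum_congr rfl fun y hy => ?_
  obtain ⟨x, rfl⟩ := SimpleFunc.mem_range.1 hy
  rw [hg, (M.isPositive _ (g.measurableSet_fiber _)).inner_left_eq_inner_right]

theorem integral_pair_map (μ : Measure Ω) [IsFiniteMeasure μ] {G : Type*} [NormedAddCommGroup G]
    (p : SimpleFunc Ω G) (F : G → ℝ) (hF : F 0 = 0) :
    ∫ x, F (p x) ∂μ = ∑ y ∈ p.range, μ.real (p ⁻¹' {y}) * F y := by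
  have h1 := SimpleFunc.map_integral (μ := μ) p F (SimpleFunc.integrable_of_isFiniteMeasure p) hF
  rw [SimpleFunc.integral_eq_integral _ (SimpleFunc.integrable_of_isFiniteMeasure _)] at h1
  simpa using h1

/-- Weighted **Cauchy–Schwarz** inequality for integrals of simple functions. -/
theorem norm_inner_simpleOp_mul_le (a b : SimpleFunc Ω ℂ) (u v : H) :
    ‖⟪u, M.simpleOp (a * b) v⟫_ℂ‖ ≤
      √(∫ x, ‖a x‖ ^ 2 ∂(M.law u)) * √(∫ x, ‖b x‖ ^ 2 ∂(M.law v)) := by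
  set p := a.pair b with hp
  have hab : a * b = p.map (fun y => y.1 * y.2) := by ext x; simp [hp]
  have ha : ∫ x, ‖a x‖ ^ 2 ∂(M.law u)
      = ∑ y ∈ p.range, (M.law u).real (p ⁻¹' {y}) * ‖y.1‖ ^ 2 :=
    integral_pair_map (M.law u) p (fun y => ‖y.1‖ ^ 2) (by simp)
  have hb : ∫ x, ‖b x‖ ^ 2 ∂(M.law v)
      = ∑ y ∈ p.range, (M.law v).real (p ⁻¹' {y}) * ‖y.2‖ ^ 2 :=
    integral_pair_map (M.law v) p (fun y => ‖y.2‖ ^ 2) (by simp)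
  rw [hab, M.simpleOp_map p _ (by simp), ha, hb]
  simp only [_root_.sum_apply, inner_sum, _root_.smul_apply,
    inner_smul_right]
  refine (norm_sum_le _ _).trans ?_
  refine le_trans ?_ (Real.sum_sqrt_mul_sqrt_le p.range (fun y => by positivity)
    (fun y => by positivity))
  refine Finset.sum_le_sum fun y _ => ?_
  rw [Real.sqrt_mul (by positivity), Real.sqrt_mul (by positivity), Real.sqrt_sq (norm_nonneg _),
    Real.sqrt_sq (norm_nonneg _), norm_mul, norm_mul]
  have := M.norm_inner_op_le u v (p.measurableSet_fiber y)
  calc ‖y.1‖ * ‖y.2‖ * ‖⟪u, M.op (p ⁻¹' {y}) v⟫_ℂ‖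
      ≤ ‖y.1‖ * ‖y.2‖ * (√((M.law u).real (p ⁻¹' {y})) * √((M.law v).real (p ⁻¹' {y}))) := by
        gcongr
    _ = _ := by ring

/-- Weighted Cauchy–Schwarz with a = 1 and u = M(g)ψ, divided by ‖u‖. It replaces a Naimark
dilation: g ↦ M(g)ψ is a contraction from L² of the law of ψ into H. -/
theorem norm_simpleOp_apply_sq_le (g : SimpleFunc Ω ℂ) (ψ : H) :
    ‖M.simpleOp g ψ‖ ^ 2 ≤ ∫ x, ‖g x‖ ^ 2 ∂(M.law ψ) := by
  have h := M.norm_inner_simpleOp_mul_le (SimpleFunc.const Ω 1) g (M.simpleOp g ψ) ψ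
  have h1 : SimpleFunc.const Ω (1 : ℂ) * g = g := by ext; simp
  rw [h1, inner_self_eq_norm_sq_to_K] at h
  simp only [SimpleFunc.const_apply, norm_one, one_pow, integral_const, smul_eq_mul, mul_one,
    M.law_real_univ, Real.sqrt_sq (norm_nonneg _)] at h
  have h2 : ‖((‖M.simpleOp g ψ‖ : ℂ)) ^ 2‖ = ‖M.simpleOp g ψ‖ ^ 2 := by simp
  have h' : ‖M.simpleOp g ψ‖ ^ 2 ≤ ‖M.simpleOp g ψ‖ * √(∫ x, ‖g x‖ ^ 2 ∂(M.law ψ)) := by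
    rw [← h2]; exact h
  have h3 : ‖M.simpleOp g ψ‖ ≤ √(∫ x, ‖g x‖ ^ 2 ∂(M.law ψ)) := by
    rcases eq_or_lt_of_le (norm_nonneg (M.simpleOp g ψ)) with h0 | h0
    · rw [← h0]; positivity
    · rw [sq] at h'
      exact le_of_mul_le_mul_left h' h0
  calc ‖M.simpleOp g ψ‖ ^ 2 ≤ √(∫ x, ‖g x‖ ^ 2 ∂(M.law ψ)) ^ 2 := by gcongr
    _ = _ := Real.sq_sqrt (integral_nonneg fun x => by positivity)

end Measurement

end MeasurementCalculus

/-! ### Unbounded integrands: limit vectors and derivatives of expectations -/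

section EstimationVectors

variable {H : Type*} [NormedAddCommGroup H] [InnerProductSpace ℂ H]
  {Ω : Type*} [MeasurableSpace Ω]

namespace Measurement

variable (M : Measurement H Ω)

theorem integrable_law_add {F : Ω → ℝ} {u v : H} (hu : Integrable F (M.law u))
    (hv : Integrable F (M.law v)) : Integrable F (M.law (u + v)) :=
  ((hu.smul_measure (by simp)).add_measure (hv.smul_measure (by simp))).mono_measure
    (M.law_add_le u v)

theorem integral_law_add_le {F : Ω → ℝ} (hF : ∀ x, 0 ≤ F x) {u v : H}
    (hu : Integrable F (M.law u)) (hv : Integrable F (M.law v)) :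
    ∫ x, F x ∂(M.law (u + v)) ≤ 2 * ∫ x, F x ∂(M.law u) + 2 * ∫ x, F x ∂(M.law v) := by
  have h2 := (hu.smul_measure (c := (2 : ℝ≥0∞)) (by simp))
  have h3 := (hv.smul_measure (c := (2 : ℝ≥0∞)) (by simp))
  refine (integral_mono_measure (M.law_add_le u v) (ae_of_all _ hF) (h2.add_measure h3)).trans ?_
  rw [integral_add_measure h2 h3, integral_smul_measure, integral_smul_measure]
  simp

/-- A sequence of real simple functions converging pointwise to `f` and dominated by `2 h`. -/
structure IsApprox (g : ℕ → SimpleFunc Ω ℂ) (f h : Ω → ℝ) : Prop where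
  conj : ∀ n x, (starRingEnd ℂ) (g n x) = g n x
  norm_le : ∀ n x, ‖g n x‖ ≤ 2 * h x
  tendsto : ∀ x, Tendsto (fun n => g n x) atTop (𝓝 (f x : ℂ))

variable {M} {g : ℕ → SimpleFunc Ω ℂ} {f h : Ω → ℝ}

theorem IsApprox.abs_le (hg : IsApprox g f h) (x : Ω) : |f x| ≤ 2 * h x := by
  have := le_of_tendsto (hg.tendsto x).norm (Eventually.of_forall fun n => hg.norm_le n x)
  simpa using this

theorem IsApprox.measurable (hg : IsApprox g f h) : Measurable (fun x => (f x : ℂ)) :=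
  measurable_of_tendsto_metrizable (fun n => (g n).measurable)
    (tendsto_pi_nhds.2 hg.tendsto)

theorem integrable_of_sq {μ : Measure Ω} [IsFiniteMeasure μ] (hm : Measurable h)
    (hi : Integrable (fun x => h x ^ 2) μ) : Integrable h μ := by
  refine Integrable.mono' ((integrable_const (1 : ℝ)).add hi) hm.aestronglyMeasurable
    (ae_of_all _ fun x => ?_)
  simp only [Pi.add_apply, Real.norm_eq_abs]
  rw [← sq_abs (h x)]
  nlinarith [sq_nonneg (|h x| - 1), abs_nonneg (h x)]

theorem IsApprox.tendsto_integral (hg : IsApprox g f h) (hm : Measurable h) {μ : Measure Ω}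
    [IsFiniteMeasure μ] (hi : Integrable (fun x => h x ^ 2) μ) :
    Tendsto (fun n => ∫ x, g n x ∂μ) atTop (𝓝 ((∫ x, f x ∂μ : ℝ) : ℂ)) := by
  rw [← integral_complex_ofReal]
  exact tendsto_integral_of_dominated_convergence (fun x => 2 * h x)
    (fun n => (g n).measurable.aestronglyMeasurable) ((integrable_of_sq hm hi).const_mul 2)
    (fun n => ae_of_all _ (hg.norm_le n)) (ae_of_all _ hg.tendsto)

/-- Dominated convergence makes the approximations Cauchy in L² of the law, and the L² contraction
carries this to H. -/
theorem IsApprox.exists_tendsto [CompleteSpace H] (hg : IsApprox g f h) (ψ : H)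
    (hi : Integrable (fun x => h x ^ 2) (M.law ψ)) :
    ∃ x, Tendsto (fun n => M.simpleOp (g n) ψ) atTop (𝓝 x) := by
  have hb : ∀ n x, ‖(g n x - f x : ℂ)‖ ^ 2 ≤ 16 * h x ^ 2 := by
    intro n x
    have h1 : ‖(g n x - f x : ℂ)‖ ≤ 4 * h x := by
      have h2 := norm_sub_le (g n x) (f x : ℂ)
      have h3 := hg.norm_le n x
      have h4 := hg.abs_le x
      rw [Complex.norm_real, Real.norm_eq_abs] at h2
      linarith
    calc ‖(g n x - f x : ℂ)‖ ^ 2 ≤ (4 * h x) ^ 2 := by gcongr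
      _ = _ := by ring
  have hmeas : ∀ n, AEStronglyMeasurable (fun x => ‖(g n x - f x : ℂ)‖ ^ 2) (M.law ψ) := fun n =>
    ((((g n).measurable.sub hg.measurable).norm).pow_const 2).aestronglyMeasurable
  have hint : ∀ n, Integrable (fun x => ‖(g n x - f x : ℂ)‖ ^ 2) (M.law ψ) := fun n =>
    Integrable.mono' (hi.const_mul 16) (hmeas n) (ae_of_all _ fun x => by
      rw [Real.norm_eq_abs, abs_of_nonneg (by positivity)]; exact hb n x)
  have hlim : Tendsto (fun n => ∫ x, ‖(g n x - f x : ℂ)‖ ^ 2 ∂(M.law ψ)) atTop (𝓝 0) := by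
    have := tendsto_integral_of_dominated_convergence (μ := M.law ψ)
      (F := fun n x => ‖(g n x - f x : ℂ)‖ ^ 2) (f := fun _ => (0 : ℝ))
      (fun x => 16 * h x ^ 2) hmeas (hi.const_mul 16)
      (fun n => ae_of_all _ fun x => by
        rw [Real.norm_eq_abs, abs_of_nonneg (by positivity)]; exact hb n x)
      (ae_of_all _ fun x => by
        have h1 := ((hg.tendsto x).sub_const (f x : ℂ)).norm.pow 2
        simpa using h1)
    simpa using this
  refine cauchySeq_tendsto_of_complete ?_
  rw [Metric.cauchySeq_iff]
  intro ε hε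
  obtain ⟨N, hN⟩ := eventually_atTop.1
    (hlim.eventually (gt_mem_nhds (show 0 < ε ^ 2 / 4 by positivity)))
  refine ⟨N, fun m hm n hn => ?_⟩
  rw [dist_eq_norm, ← _root_.sub_apply, ← M.simpleOp_sub]
  refine lt_of_pow_lt_pow_left₀ 2 hε.le ?_
  refine (M.norm_simpleOp_apply_sq_le (g m - g n) ψ).trans_lt ?_
  have h1 : ∫ x, ‖(g m - g n) x‖ ^ 2 ∂(M.law ψ)
      ≤ ∫ x, (2 * ‖(g m x - f x : ℂ)‖ ^ 2 + 2 * ‖(g n x - f x : ℂ)‖ ^ 2) ∂(M.law ψ) := by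
    refine integral_mono_of_nonneg (ae_of_all _ fun x => by positivity)
      (((hint m).const_mul 2).add ((hint n).const_mul 2)) (ae_of_all _ fun x => ?_)
    have h2 : (g m - g n) x = (g m x - f x) - (g n x - f x) := by simp
    have h3 := norm_sub_le (g m x - f x : ℂ) (g n x - f x)
    rw [← h2] at h3
    have h4 : ‖(g m - g n) x‖ ^ 2 ≤ (‖(g m x - f x : ℂ)‖ + ‖(g n x - f x : ℂ)‖) ^ 2 := by gcongr
    change ‖(g m - g n) x‖ ^ 2 ≤ 2 * ‖(g m x - f x : ℂ)‖ ^ 2 + 2 * ‖(g n x - f x : ℂ)‖ ^ 2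
    nlinarith [sq_nonneg (‖(g m x - f x : ℂ)‖ - ‖(g n x - f x : ℂ)‖)]
  rw [integral_add ((hint m).const_mul 2) ((hint n).const_mul 2), integral_const_mul,
    integral_const_mul] at h1
  linarith [hN m hm, hN n hn]

/-- Polarization: the cross terms have equal real parts because k is real. A difference of
expectations thereby becomes linear in the increment ψ - χ. -/
theorem re_inner_sub_simpleOp_add (k : SimpleFunc Ω ℂ) (hk : ∀ x, (starRingEnd ℂ) (k x) = k x)
    (ψ χ : H) :
    (⟪ψ - χ, M.simpleOp k (ψ + χ)⟫_ℂ).re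
      = (∫ x, k x ∂(M.law ψ)).re - (∫ x, k x ∂(M.law χ)).re := by
  rw [← M.inner_simpleOp_self, ← M.inner_simpleOp_self]
  have h : (⟪χ, M.simpleOp k ψ⟫_ℂ).re = (⟪ψ, M.simpleOp k χ⟫_ℂ).re := by
    rw [← M.inner_simpleOp_comm k hk, ← inner_conj_symm, Complex.conj_re]
  simp only [map_add, inner_sub_left, inner_add_right, Complex.sub_re, Complex.add_re, h]
  ring

/-- The relative error of the `n`-th approximation, a function with values in `[0, 1]`. -/
noncomputable def relError (g : ℕ → SimpleFunc Ω ℂ) (f : Ω → ℝ) (n : ℕ) (x : Ω) : ℝ :=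
  ‖(f x - g n x : ℂ)‖ / (1 + ‖(f x : ℂ)‖ + ‖g n x‖)

theorem div_one_add_le_one (a b : ℂ) : ‖a - b‖ / (1 + ‖a‖ + ‖b‖) ≤ 1 := by
  rw [div_le_one (by positivity)]
  linarith [norm_sub_le a b]

theorem relError_nonneg (n : ℕ) (x : Ω) : 0 ≤ relError g f n x := by
  unfold relError; positivity

theorem IsApprox.measurable_relError (hg : IsApprox g f h) (n : ℕ) :
    Measurable (relError g f n) :=
  (hg.measurable.sub (g n).measurable).norm.div
    ((measurable_const.add hg.measurable.norm).add (g n).measurable.norm)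

theorem relError_sq_le (n : ℕ) (x : Ω) : relError g f n x ^ 2 ≤ 1 :=
  pow_le_one₀ (relError_nonneg n x) (div_one_add_le_one _ _)

theorem IsApprox.integrable_relError (hg : IsApprox g f h) (n : ℕ) (μ : Measure Ω)
    [IsFiniteMeasure μ] : Integrable (fun x => relError g f n x ^ 2) μ :=
  Integrable.mono' (integrable_const 1)
    ((hg.measurable_relError n).pow_const 2).aestronglyMeasurable
    (ae_of_all _ fun x => by
      rw [Real.norm_eq_abs, abs_of_nonneg (by positivity)]; exact relError_sq_le n x)

theorem IsApprox.tendsto_integral_relError (hg : IsApprox g f h) (μ : Measure Ω)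
    [IsFiniteMeasure μ] :
    Tendsto (fun n => ∫ x, relError g f n x ^ 2 ∂μ) atTop (𝓝 0) := by
  have := tendsto_integral_of_dominated_convergence (μ := μ)
    (F := fun n x => relError g f n x ^ 2) (f := fun _ => (0 : ℝ)) (fun _ => 1)
    (fun n => ((hg.measurable_relError n).pow_const 2).aestronglyMeasurable) (integrable_const 1)
    (fun n => ae_of_all _ fun x => by
      rw [Real.norm_eq_abs, abs_of_nonneg (by positivity)]; exact relError_sq_le n x)
    (ae_of_all _ fun x => by
      have h1 : Tendsto (fun n => relError g f n x) atTop
          (𝓝 (‖(f x - f x : ℂ)‖ / (1 + ‖(f x : ℂ)‖ + ‖(f x : ℂ)‖))) :=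
        ((hg.tendsto x).const_sub _).norm.div ((hg.tendsto x).norm.const_add _) (by positivity)
      simpa using h1.pow 2)
  simpa using this

/-- The approximation error of the sesquilinear form of `f`, uniformly in the right argument. -/
theorem IsApprox.norm_inner_sub_le (hg : IsApprox g f h) {s v : H} {K : ℝ}
    (hi : Integrable (fun x => h x ^ 2) (M.law v))
    (hK : ∫ x, (2 + 32 * h x ^ 2) ∂(M.law v) ≤ K) {L : ℝ}
    (hL : Tendsto (fun m => (⟪s, M.simpleOp (g m) v⟫_ℂ).re) atTop (𝓝 L)) (n : ℕ) :
    |L - (⟪s, M.simpleOp (g n) v⟫_ℂ).re|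
      ≤ √(∫ x, relError g f n x ^ 2 ∂(M.law s)) * √K := by
  -- The law of s need not have a second moment. Hence g_m - g_n is split as a product a·b: a is
  -- bounded by 1 and integrated against the law of s, while the growth sits in b, controlled by the
  -- second moment under v.
  set b : ℕ → SimpleFunc Ω ℂ := fun m =>
    ((g m).pair (g n)).map (fun y => ((1 + ‖y.1‖ + ‖y.2‖ : ℝ) : ℂ)) with hb
  have hbx : ∀ m x, b m x = ((1 + ‖g m x‖ + ‖g n x‖ : ℝ) : ℂ) := fun m x => by simp [hb]
  have hb0 : ∀ m x, b m x ≠ 0 := fun m x => by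
    rw [hbx]; exact_mod_cast (show (0 : ℝ) < 1 + ‖g m x‖ + ‖g n x‖ by positivity).ne'
  have hbn : ∀ m x, ‖b m x‖ = 1 + ‖g m x‖ + ‖g n x‖ := fun m x => by
    rw [hbx, Complex.norm_real, Real.norm_eq_abs, abs_of_nonneg (by positivity)]
  set a : ℕ → SimpleFunc Ω ℂ := fun m => (g m - g n) / b m with ha
  have hax : ∀ m x, ‖a m x‖ = ‖g m x - g n x‖ / (1 + ‖g m x‖ + ‖g n x‖) := fun m x => by
    simp [ha, hbn]
  have hab : ∀ m, a m * b m = g m - g n := fun m => by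
    ext x
    simp [ha, div_mul_cancel₀ _ (hb0 m x)]
  have hbK : ∀ m, ∫ x, ‖b m x‖ ^ 2 ∂(M.law v) ≤ K := by
    intro m
    refine le_trans ?_ hK
    refine integral_mono_of_nonneg (ae_of_all _ fun x => by positivity)
      ((integrable_const 2).add (hi.const_mul 32)) (ae_of_all _ fun x => ?_)
    have h1 := hg.norm_le m x
    have h2 := hg.norm_le n x
    have h3 : ‖b m x‖ ≤ 1 + 4 * h x := by rw [hbn]; linarith
    have h4 : ‖b m x‖ ^ 2 ≤ (1 + 4 * h x) ^ 2 := by gcongr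
    change ‖b m x‖ ^ 2 ≤ 2 + 32 * h x ^ 2
    nlinarith [sq_nonneg (1 - 4 * h x)]
  have hlim : Tendsto (fun m => ∫ x, ‖a m x‖ ^ 2 ∂(M.law s)) atTop
      (𝓝 (∫ x, relError g f n x ^ 2 ∂(M.law s))) := by
    refine tendsto_integral_of_dominated_convergence (fun _ => 1)
      (fun m => (((a m).measurable.norm).pow_const 2).aestronglyMeasurable) (integrable_const 1)
      (fun m => ae_of_all _ fun x => ?_) (ae_of_all _ fun x => ?_)
    · rw [Real.norm_eq_abs, abs_of_nonneg (by positivity), hax]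
      exact pow_le_one₀ (by positivity) (div_one_add_le_one _ _)
    · simp only [hax, relError]
      exact ((((hg.tendsto x).sub_const _).norm).div
        (((hg.tendsto x).norm.const_add 1).add_const _) (by positivity)).pow 2
  refine le_of_tendsto_of_tendsto (hL.sub_const _).abs
    ((hlim.sqrt).mul_const (√K)) (Eventually.of_forall fun m => ?_)
  have h1 := M.norm_inner_simpleOp_mul_le (a m) (b m) s v
  rw [hab, M.simpleOp_sub, _root_.sub_apply, inner_sub_right] at h1
  have h2 := (Complex.abs_re_le_norm _).trans h1
  rw [Complex.sub_re] at h2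
  exact h2.trans (mul_le_mul_of_nonneg_left (Real.sqrt_le_sqrt (hbK m)) (Real.sqrt_nonneg _))

/-- The derivative of an expectation along a curve of state vectors. -/
theorem IsApprox.deriv_eq (hg : IsApprox g f h) (hm : Measurable h) {ψ : ℝ → H} {w x : H} {δ C : ℝ}
    (hψ : HasDerivAt ψ w 0)
    (hnorm : ∀ᶠ t in 𝓝 0, ‖ψ t‖ = 1)
    (hbd : ∀ᶠ t in 𝓝 0, Integrable (fun y => h y ^ 2) (M.law (ψ t)) ∧
      ∫ y, h y ^ 2 ∂(M.law (ψ t)) ≤ C)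
    (hδ : HasDerivAt (fun t => ∫ y, f y ∂(M.law (ψ t))) δ 0)
    (hx : Tendsto (fun n => M.simpleOp (g n) (ψ 0)) atTop (𝓝 x)) :
    δ = 2 * (⟪w, x⟫_ℂ).re := by
  -- Here (1 + 4h)² ≤ 2 + 32h², and `law_add_le` weights each of the two states ψ t and ψ 0 by 2.
  set K : ℝ := 4 * (2 + 32 * C) with hK
  set s : ℝ → H := fun t => t⁻¹ • (ψ t - ψ 0) with hs
  have hslim : Tendsto s (𝓝[≠] 0) (𝓝 w) := by
    have := hψ.tendsto_slope
    refine this.congr fun t => ?_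
    simp [slope, hs]
  have hψlim : Tendsto ψ (𝓝[≠] 0) (𝓝 (ψ 0)) := hψ.continuousAt.tendsto.mono_left nhdsWithin_le_nhds
  have hqlim : Tendsto (fun t => t⁻¹ * ((∫ y, f y ∂(M.law (ψ t))) - ∫ y, f y ∂(M.law (ψ 0))))
      (𝓝[≠] 0) (𝓝 δ) := by
    have := hδ.tendsto_slope
    refine this.congr fun t => ?_
    simp [slope]
  have hsecond : ∀ᶠ t in 𝓝 0, ∫ y, (2 + 32 * h y ^ 2) ∂(M.law (ψ t)) ≤ 2 + 32 * C ∧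
      Integrable (fun y => 2 + 32 * h y ^ 2) (M.law (ψ t)) := by
    filter_upwards [hnorm, hbd] with t h1 h2
    refine ⟨?_, (integrable_const 2).add (h2.1.const_mul 32)⟩
    rw [integral_add (integrable_const 2) (h2.1.const_mul 32), integral_const_mul, integral_const,
      M.law_real_univ, h1]
    simp only [smul_eq_mul]
    linarith [h2.2]
  have h0 := hsecond.self_of_nhds
  have h0' := hbd.self_of_nhds
  -- The error of the n-th approximation is bounded uniformly in the difference quotient s t, so t →
  -- 0 can be taken before n → ∞. The limit of the bound involves the law of w only.
  have hn : ∀ n, |δ - 2 * (⟪w, M.simpleOp (g n) (ψ 0)⟫_ℂ).re|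
      ≤ √(2 * ∫ y, relError g f n y ^ 2 ∂(M.law w)) * √K := by
    intro n
    have hR : Tendsto (fun t => √(2 * ‖s t - w‖ ^ 2 + 2 * ∫ y, relError g f n y ^ 2 ∂(M.law w)) * √K)
        (𝓝[≠] 0) (𝓝 (√(2 * ∫ y, relError g f n y ^ 2 ∂(M.law w)) * √K)) := by
      have h1 : Tendsto (fun t => ‖s t - w‖) (𝓝[≠] 0) (𝓝 0) := by
        simpa using (hslim.sub_const w).norm
      have h2 := (((h1.pow 2).const_mul 2).add_const
        (2 * ∫ y, relError g f n y ^ 2 ∂(M.law w))).sqrt.mul_const (√K)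
      simpa using h2
    have hLft : Tendsto (fun t => |t⁻¹ * ((∫ y, f y ∂(M.law (ψ t))) - ∫ y, f y ∂(M.law (ψ 0)))
        - (⟪s t, M.simpleOp (g n) (ψ t + ψ 0)⟫_ℂ).re|) (𝓝[≠] 0)
        (𝓝 |δ - 2 * (⟪w, M.simpleOp (g n) (ψ 0)⟫_ℂ).re|) := by
      have h1 : Tendsto (fun t => (⟪s t, M.simpleOp (g n) (ψ t + ψ 0)⟫_ℂ).re) (𝓝[≠] 0)
          (𝓝 (⟪w, M.simpleOp (g n) (ψ 0 + ψ 0)⟫_ℂ).re) :=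
        (Complex.continuous_re.tendsto _).comp
          (hslim.inner (((M.simpleOp (g n)).continuous.tendsto _).comp (hψlim.add_const _)))
      have h2 : (⟪w, M.simpleOp (g n) (ψ 0 + ψ 0)⟫_ℂ).re
          = 2 * (⟪w, M.simpleOp (g n) (ψ 0)⟫_ℂ).re := by
        rw [map_add, inner_add_right, Complex.add_re]; ring
      rw [h2] at h1
      exact (hqlim.sub h1).abs
    refine le_of_tendsto_of_tendsto hLft hR ?_
    filter_upwards [hsecond.filter_mono nhdsWithin_le_nhds, hbd.filter_mono nhdsWithin_le_nhds]
      with t ht ht'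
    have hL : Tendsto (fun m => (⟪s t, M.simpleOp (g m) (ψ t + ψ 0)⟫_ℂ).re) atTop
        (𝓝 (t⁻¹ * ((∫ y, f y ∂(M.law (ψ t))) - ∫ y, f y ∂(M.law (ψ 0))))) := by
      have h1 : ∀ m, (⟪s t, M.simpleOp (g m) (ψ t + ψ 0)⟫_ℂ).re
          = t⁻¹ * ((∫ y, g m y ∂(M.law (ψ t))).re - (∫ y, g m y ∂(M.law (ψ 0))).re) := by
        intro m
        rw [← re_inner_sub_simpleOp_add (g m) (hg.conj m)]
        simp only [hs]
        rw [← Complex.coe_smul, inner_smul_left, Complex.conj_ofReal, Complex.re_ofReal_mul]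
      simp only [h1]
      have h2 := (Complex.continuous_re.tendsto _).comp (hg.tendsto_integral hm ht'.1)
      have h3 := (Complex.continuous_re.tendsto _).comp (hg.tendsto_integral hm h0'.1)
      exact (h2.sub h3).const_mul _
    have hKt : ∫ y, (2 + 32 * h y ^ 2) ∂(M.law (ψ t + ψ 0)) ≤ K := by
      refine (M.integral_law_add_le (fun y => by positivity) ht.2 h0.2).trans ?_
      rw [hK]
      linarith [ht.1, h0.1]
    refine (hg.norm_inner_sub_le (M.integrable_law_add ht'.1 h0'.1) hKt hL n).trans ?_
    gcongr
    -- Splitting s t = (s t - w) + w, the first part contributes at most its total mass ‖s t - w‖²,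
    -- as the relative error is at most 1.
    have h4 := M.integral_law_add_le (F := fun y => relError g f n y ^ 2) (u := s t - w) (v := w)
      (fun y => by positivity) (hg.integrable_relError n _) (hg.integrable_relError n _)
    rw [sub_add_cancel] at h4
    refine h4.trans ?_
    gcongr
    rw [← M.law_real_univ]
    have h5 := integral_mono (hg.integrable_relError n (M.law (s t - w))) (integrable_const 1)
      (fun y => relError_sq_le n y)
    simpa using h5
  have hlim1 : Tendsto (fun n => |δ - 2 * (⟪w, M.simpleOp (g n) (ψ 0)⟫_ℂ).re|) atTop
      (𝓝 |δ - 2 * (⟪w, x⟫_ℂ).re|) :=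
    ((((Complex.continuous_re.tendsto _).comp (tendsto_const_nhds.inner hx)).const_mul 2).const_sub
      δ).abs
  have hlim2 : Tendsto (fun n => √(2 * ∫ y, relError g f n y ^ 2 ∂(M.law w)) * √K) atTop (𝓝 0) := by
    have := ((hg.tendsto_integral_relError (M.law w)).const_mul 2).sqrt.mul_const (√K)
    simpa using this
  have := le_of_tendsto_of_tendsto' hlim1 hlim2 hn
  exact sub_eq_zero.1 (abs_eq_zero.1 (le_antisymm this (abs_nonneg _)))

end Measurement

end EstimationVectors

/-! ### Estimation vectors of a locally unbiased estimator -/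

section Necessity

/-- The Hermitian form `c ↦ c^* V c` of a real symmetric matrix `V`. -/
noncomputable def hermForm {m : ℕ} (V : Matrix (Fin m) (Fin m) ℝ) (c : Fin m → ℂ) : ℝ :=
  ∑ i, ∑ j, ((starRingEnd ℂ) (c i) * c j).re * V i j

theorem norm_sum_mul_ofReal_sq {m : ℕ} (c : Fin m → ℂ) (d : Fin m → ℝ) :
    ‖∑ j, c j * (d j : ℂ)‖ ^ 2
      = ∑ i, ∑ j, ((starRingEnd ℂ) (c i) * c j).re * (d i * d j) := by
  have h1 : ((‖∑ j, c j * (d j : ℂ)‖ ^ 2 : ℝ) : ℂ)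
      = ∑ i, ∑ j, ((starRingEnd ℂ) (c i) * c j) * ((d i * d j : ℝ) : ℂ) := by
    rw [← Complex.normSq_eq_norm_sq, Complex.normSq_eq_conj_mul_self, map_sum, Finset.sum_mul_sum]
    refine Finset.sum_congr rfl fun i _ => Finset.sum_congr rfl fun j _ => ?_
    rw [map_mul, Complex.conj_ofReal]
    push_cast
    ring
  have h2 := congrArg Complex.re h1
  rw [Complex.ofReal_re] at h2
  rw [h2, Complex.re_sum]
  refine Finset.sum_congr rfl fun i _ => ?_
  rw [Complex.re_sum]
  exact Finset.sum_congr rfl fun j _ => Complex.re_mul_ofReal _ _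

variable {H : Type*} [NormedAddCommGroup H] [InnerProductSpace ℂ H] {m : ℕ}

/-- Simple approximations of the identity of `ℝ^m`. -/
noncomputable def approxId (m n : ℕ) : SimpleFunc (Fin m → ℝ) (Fin m → ℝ) :=
  SimpleFunc.approxOn id measurable_id Set.univ 0 (Set.mem_univ _) n

/-- Simple approximations of the `j`-th coordinate of `ℝ^m`. -/
noncomputable def approxCoord (j : Fin m) (n : ℕ) : SimpleFunc (Fin m → ℝ) ℂ :=
  (approxId m n).map (fun y => (y j : ℂ))

theorem isApprox_approxCoord (j : Fin m) :
    Measurement.IsApprox (approxCoord j) (fun x : Fin m → ℝ => x j) (fun x => ‖x‖) where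
  conj n x := by simp [approxCoord]
  norm_le n x := by
    have h1 := SimpleFunc.norm_approxOn_zero_le (f := (id : (Fin m → ℝ) → (Fin m → ℝ)))
      measurable_id (Set.mem_univ 0) x n
    have h2 : ‖approxCoord j n x‖ = ‖approxId m n x j‖ := by
      simp [approxCoord]
    rw [h2]
    have h3 := norm_le_pi_norm (approxId m n x) j
    simp only [approxId, id] at h1 h3 ⊢
    linarith
  tendsto x := by
    have h1 := SimpleFunc.tendsto_approxOn (f := (id : (Fin m → ℝ) → (Fin m → ℝ)))
      measurable_id (Set.mem_univ 0) (x := x) (by simp)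
    have h2 := (Complex.continuous_ofReal.tendsto _).comp
      (((continuous_apply j).tendsto _).comp h1)
    exact h2

theorem integrable_norm_sq_of_lintegral {μ : Measure (Fin m → ℝ)} {C : ℝ≥0}
    (hC : ∫⁻ x, ‖x‖ₑ ^ 2 ∂μ ≤ C) :
    Integrable (fun x => ‖x‖ ^ 2) μ ∧ ∫ x, ‖x‖ ^ 2 ∂μ ≤ C := by
  have h1 : ∀ x : Fin m → ℝ, ENNReal.ofReal (‖x‖ ^ 2) = ‖x‖ₑ ^ 2 := fun x => by
    rw [ENNReal.ofReal_pow (norm_nonneg _), ofReal_norm]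
  have hm : AEStronglyMeasurable (fun x : Fin m → ℝ => ‖x‖ ^ 2) μ :=
    (measurable_norm.pow_const 2).aestronglyMeasurable
  constructor
  · refine ⟨hm, ?_⟩
    rw [hasFiniteIntegral_iff_ofReal (ae_of_all _ fun x => by positivity)]
    simp only [h1]
    exact hC.trans_lt ENNReal.coe_lt_top
  · rw [integral_eq_lintegral_of_nonneg_ae (ae_of_all _ fun x => by positivity) hm]
    simp only [h1]
    exact ENNReal.toReal_le_of_le_ofReal C.2 (by simpa using hC)

namespace PureStateModel

variable (𝓜 : PureStateModel H m) {θ : Fin m → ℝ}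

theorem hasDerivAt_line (i : Fin m) :
    HasDerivAt (fun t : ℝ => θ + t • (Pi.single i 1 : Fin m → ℝ)) (Pi.single i 1) 0 := by
  simpa using ((hasDerivAt_id (0 : ℝ)).smul_const (Pi.single i 1 : Fin m → ℝ)).const_add θ

theorem hasDerivAt_state (hθ : θ ∈ 𝓜.Θ) (i : Fin m) :
    HasDerivAt (fun t : ℝ => 𝓜.φ (θ + t • (Pi.single i 1 : Fin m → ℝ)))
      (partialDeriv 𝓜.φ θ i) 0 := by
  have hd : HasFDerivAt 𝓜.φ (fderiv ℝ 𝓜.φ θ) (θ + (0 : ℝ) • (Pi.single i 1 : Fin m → ℝ)) := by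
    simpa using ((𝓜.contDiffOn.contDiffAt (𝓜.isOpen_Θ.mem_nhds hθ)).differentiableAt
      (by simp)).hasFDerivAt
  exact hd.comp_hasDerivAt 0 (hasDerivAt_line i)

theorem tendsto_line (i : Fin m) :
    Tendsto (fun t : ℝ => θ + t • (Pi.single i 1 : Fin m → ℝ)) (𝓝 0) (𝓝 θ) := by
  simpa using (hasDerivAt_line (θ := θ) i).continuousAt.tendsto

theorem eventually_norm_eq_one (hθ : θ ∈ 𝓜.Θ) (i : Fin m) :
    ∀ᶠ t : ℝ in 𝓝 0, ‖𝓜.φ (θ + t • (Pi.single i 1 : Fin m → ℝ))‖ = 1 := by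
  filter_upwards [(tendsto_line i).eventually (𝓜.isOpen_Θ.mem_nhds hθ)] with t ht
  exact 𝓜.norm_eq_one _ ht

theorem re_inner_horizontalLift {x : H} (hx : ⟪𝓜.φ θ, x⟫_ℂ = 0) (i : Fin m) :
    (⟪horizontalLift 𝓜.φ θ i, x⟫_ℂ).re = 2 * (⟪partialDeriv 𝓜.φ θ i, x⟫_ℂ).re := by
  simp [horizontalLift, hx, mul_comm]

theorem re_inner_partialDeriv (hθ : θ ∈ 𝓜.Θ) (i : Fin m) :
    (⟪partialDeriv 𝓜.φ θ i, 𝓜.φ θ⟫_ℂ).re = 0 := by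
  have h1 := 𝓜.hasDerivAt_state hθ i
  have h2 := h1.inner ℂ h1
  have h3 : HasDerivAt (fun t : ℝ => ⟪𝓜.φ (θ + t • (Pi.single i 1 : Fin m → ℝ)),
      𝓜.φ (θ + t • (Pi.single i 1 : Fin m → ℝ))⟫_ℂ) 0 0 := by
    refine (hasDerivAt_const (0 : ℝ) (1 : ℂ)).congr_of_eventuallyEq ?_
    filter_upwards [𝓜.eventually_norm_eq_one hθ i] with t ht
    rw [inner_self_eq_norm_sq_to_K, ht]; simp
  have h4 := h2.unique h3
  have h5 := congrArg Complex.re h4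
  rw [Complex.add_re] at h5
  have h6 : (⟪𝓜.φ θ, partialDeriv 𝓜.φ θ i⟫_ℂ).re = (⟪partialDeriv 𝓜.φ θ i, 𝓜.φ θ⟫_ℂ).re := by
    rw [← inner_conj_symm, Complex.conj_re]
  simp only [zero_smul, add_zero, Complex.zero_re, h6] at h5
  linarith

/-- The L² contraction bound for the complex combination ∑ c_j (x_j - θ_j), passed to the limit from
simple functions. Complex coefficients are essential: real ones would only bound the real part of
the Gram matrix. -/
theorem norm_sq_le_hermForm_cov {M : Measurement H (Fin m → ℝ)}
    (hi : Integrable (fun x => ‖x‖ ^ 2) (M.law (𝓜.φ θ))) {y : Fin m → H}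
    (hy : ∀ j, Tendsto (fun n => M.simpleOp (approxCoord j n) (𝓜.φ θ)) atTop (𝓝 (y j)))
    (c : Fin m → ℂ) :
    ‖∑ j, c j • (y j - (θ j : ℂ) • 𝓜.φ θ)‖ ^ 2 ≤ hermForm (𝓜.cov θ M) c := by
  set μ := M.law (𝓜.φ θ) with hμ
  set k : ℂ := ∑ j, c j * (θ j : ℂ) with hk
  set g : ℕ → SimpleFunc (Fin m → ℝ) ℂ := fun n =>
    (approxId m n).map (fun y => ∑ j, c j * (y j : ℂ)) - SimpleFunc.const _ k with hg
  have hop : ∀ n, M.simpleOp (g n) (𝓜.φ θ)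
      = ∑ j, c j • (M.simpleOp (approxCoord j n) (𝓜.φ θ) - (θ j : ℂ) • 𝓜.φ θ) := by
    intro n
    simp only [hg, M.simpleOp_sub, M.simpleOp_const, M.simpleOp_map_sum (approxId m n) c
      (fun j y => (y j : ℂ)) (by simp), approxCoord, hk, _root_.sub_apply, _root_.sum_apply,
      _root_.smul_apply, one_apply_eq_self, smul_sub, Finset.sum_sub_distrib, Finset.sum_smul,
      mul_smul]
  have hlim1 : Tendsto (fun n => ‖M.simpleOp (g n) (𝓜.φ θ)‖ ^ 2) atTop
      (𝓝 (‖∑ j, c j • (y j - (θ j : ℂ) • 𝓜.φ θ)‖ ^ 2)) := by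
    simp only [hop]
    exact (tendsto_finsetSum _ fun j _ => ((hy j).sub_const _).const_smul (c j)).norm.pow 2
  have hgx : ∀ n x, g n x = ∑ j, c j * (approxCoord j n x - θ j) := by
    intro n x
    simp [hg, hk, approxCoord, mul_sub, Finset.sum_sub_distrib]
  set S : ℝ := ∑ j, ‖c j‖
  set T : ℝ := ∑ j, ‖c j‖ * |θ j|
  have hbd : ∀ (n : ℕ) (x : Fin m → ℝ), ‖‖g n x‖ ^ 2‖ ≤ 8 * S ^ 2 * ‖x‖ ^ 2 + 2 * T ^ 2 := by
    intro n x
    have h1 : ‖g n x‖ ≤ 2 * S * ‖x‖ + T := by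
      rw [hgx]
      calc ‖∑ j, c j * (approxCoord j n x - θ j)‖
          ≤ ∑ j, ‖c j‖ * (2 * ‖x‖ + |θ j|) := by
            refine (norm_sum_le _ _).trans (Finset.sum_le_sum fun j _ => ?_)
            rw [norm_mul]
            gcongr
            refine (norm_sub_le _ _).trans ?_
            rw [Complex.norm_real, Real.norm_eq_abs]
            gcongr
            exact (isApprox_approxCoord j).norm_le n x
        _ = 2 * S * ‖x‖ + T := by
            simp only [mul_add, Finset.sum_add_distrib, S, T, Finset.mul_sum, Finset.sum_mul]
            congr 1
            exact Finset.sum_congr rfl fun j _ => by ring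
    have h2 : ‖g n x‖ ^ 2 ≤ (2 * S * ‖x‖ + T) ^ 2 := by gcongr
    rw [Real.norm_eq_abs, abs_of_nonneg (by positivity)]
    nlinarith [sq_nonneg (2 * S * ‖x‖ - T)]
  have hlim3 : ∀ x : Fin m → ℝ, Tendsto (fun n => ‖g n x‖ ^ 2) atTop
      (𝓝 (‖∑ j, c j * ((x j - θ j : ℝ) : ℂ)‖ ^ 2)) := by
    intro x
    simp only [hgx, Complex.ofReal_sub]
    exact (tendsto_finsetSum _ fun j _ =>
      (((isApprox_approxCoord j).tendsto x).sub_const _).const_mul (c j)).norm.pow 2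
  have hint2 : Integrable (fun x : Fin m → ℝ => 8 * S ^ 2 * ‖x‖ ^ 2 + 2 * T ^ 2) μ :=
    (hi.const_mul _).add (integrable_const _)
  clear_value g S T
  have hlim2 : Tendsto (fun n => ∫ x, ‖g n x‖ ^ 2 ∂μ) atTop
      (𝓝 (∫ x, ‖∑ j, c j * ((x j - θ j : ℝ) : ℂ)‖ ^ 2 ∂μ)) :=
    tendsto_integral_of_dominated_convergence _
      (fun n => ((g n).measurable.norm.pow_const 2).aestronglyMeasurable) hint2
      (fun n => ae_of_all _ (hbd n)) (ae_of_all _ hlim3)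
  refine (le_of_tendsto_of_tendsto' hlim1 hlim2 fun n =>
    M.norm_simpleOp_apply_sq_le (g n) (𝓜.φ θ)).trans_eq ?_
  have hint : ∀ i j : Fin m, Integrable (fun x : Fin m → ℝ => (x i - θ i) * (x j - θ j)) μ := by
    intro i j
    refine Integrable.mono' ((hi.const_mul 2).add (integrable_const (|θ i| ^ 2 + |θ j| ^ 2)))
      (((measurable_pi_apply i).sub_const _).mul
        ((measurable_pi_apply j).sub_const _)).aestronglyMeasurable (ae_of_all _ fun x => ?_)
    have h1 : ∀ i, |x i - θ i| ≤ ‖x‖ + |θ i| := fun i =>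
      (abs_sub _ _).trans (add_le_add_left (by simpa using norm_le_pi_norm x i) _)
    change ‖(x i - θ i) * (x j - θ j)‖ ≤ 2 * ‖x‖ ^ 2 + (|θ i| ^ 2 + |θ j| ^ 2)
    rw [Real.norm_eq_abs, abs_mul]
    have h2 := mul_le_mul (h1 i) (h1 j) (abs_nonneg _) (by positivity)
    nlinarith [sq_nonneg (‖x‖ - |θ i|), sq_nonneg (‖x‖ - |θ j|), sq_nonneg (|θ i| - |θ j|)]
  simp only [norm_sum_mul_ofReal_sq]
  rw [integral_finsetSum _ fun i _ => integrable_finsetSum _ fun j _ => (hint i j).const_mul _]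
  refine Finset.sum_congr rfl fun i _ => ?_
  rw [integral_finsetSum _ fun j _ => (hint i j).const_mul _]
  refine Finset.sum_congr rfl fun j _ => ?_
  rw [integral_const_mul]
  rfl

/-- The vectors `∫ (θ̂^j - θ^j) M(dθ̂) φ` of a locally unbiased estimator. -/
theorem exists_estimationVectors [CompleteSpace H] (hθ : θ ∈ 𝓜.Θ)
    {M : Measurement H (Fin m → ℝ)} (hM : 𝓜.IsLocallyUnbiased θ M) :
    ∃ x : Fin m → H, (∀ j, ⟪𝓜.φ θ, x j⟫_ℂ = 0) ∧
      (∀ i j, (⟪horizontalLift 𝓜.φ θ i, x j⟫_ℂ).re = if i = j then 1 else 0) ∧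
      ∀ c : Fin m → ℂ, ‖∑ j, c j • x j‖ ^ 2 ≤ hermForm (𝓜.cov θ M) c := by
  obtain ⟨C, hC⟩ := hM.bounded_moment
  have hC' := hC.mono fun θ' h => integrable_norm_sq_of_lintegral h
  have h0 := hC'.self_of_nhds
  set μ := M.law (𝓜.φ θ) with hμ
  have hm : Measurable fun x : Fin m → ℝ => ‖x‖ := measurable_norm
  choose y hy using fun j => (isApprox_approxCoord j).exists_tendsto (M := M) (𝓜.φ θ) h0.1
  have hinner : ∀ j, ⟪𝓜.φ θ, y j⟫_ℂ = θ j := by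
    intro j
    have h1 : Tendsto (fun n => ⟪𝓜.φ θ, M.simpleOp (approxCoord j n) (𝓜.φ θ)⟫_ℂ) atTop
        (𝓝 ⟪𝓜.φ θ, y j⟫_ℂ) := tendsto_const_nhds.inner (hy j)
    simp only [M.inner_simpleOp_self] at h1
    have h2 := (isApprox_approxCoord j).tendsto_integral hm h0.1
    rw [tendsto_nhds_unique h1 h2]
    exact_mod_cast hM.mean_eq j
  have hφ : ⟪𝓜.φ θ, 𝓜.φ θ⟫_ℂ = 1 := by
    rw [inner_self_eq_norm_sq_to_K, 𝓜.norm_eq_one θ hθ]; simp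
  have hx0 : ∀ j, ⟪𝓜.φ θ, y j - (θ j : ℂ) • 𝓜.φ θ⟫_ℂ = 0 := by
    intro j
    rw [inner_sub_right, inner_smul_right, hinner, hφ]; simp
  refine ⟨fun j => y j - (θ j : ℂ) • 𝓜.φ θ, hx0, ?_, 𝓜.norm_sq_le_hermForm_cov h0.1 hy⟩
  -- Subtracting θ^j φ does not affect the derivative, since ⟨∂_i φ|φ⟩ is purely imaginary.
  · intro i j
    rw [𝓜.re_inner_horizontalLift (hx0 j), inner_sub_right, inner_smul_right, Complex.sub_re,
      Complex.re_ofReal_mul, 𝓜.re_inner_partialDeriv hθ, mul_zero, sub_zero]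
    symm
    refine (isApprox_approxCoord j).deriv_eq (M := M) hm (C := C)
      (ψ := fun t : ℝ => 𝓜.φ (θ + t • (Pi.single i 1 : Fin m → ℝ))) (𝓜.hasDerivAt_state hθ i)
      (𝓜.eventually_norm_eq_one hθ i) ((tendsto_line i).eventually hC')
      (hM.hasDerivAt_mean i j) ?_
    simpa using hy j

theorem isSymm_cov (M : Measurement H (Fin m → ℝ)) : (𝓜.cov θ M).IsSymm := by
  ext i j
  simp only [Matrix.transpose_apply, cov, Matrix.of_apply]
  exact integral_congr_ae (ae_of_all _ fun x => mul_comm _ _)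

end PureStateModel

end Necessity

/-! ### Measurements with finitely many outcomes -/

section FiniteMeasurement

variable {H : Type*} [NormedAddCommGroup H] [InnerProductSpace ℂ H]
  {Ω : Type*} [MeasurableSpace Ω] {ι : Type*} [Fintype ι]

/-- The measurement with operators `E k` and outcomes `y k`. -/
noncomputable def Measurement.ofFintype (E : ι → H →L[ℂ] H) (hE : ∀ k, (E k).IsPositive)
    (hsum : ∑ k, E k = 1) (y : ι → Ω) : Measurement H Ω where
  op B := ∑ k, B.indicator (fun _ => E k) (y k)
  isPositive B _ := by
    refine ContinuousLinearMap.isPositive_sum _ fun k _ => ?_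
    by_cases h : y k ∈ B
    · simpa [h] using hE k
    · simp [h]
  op_empty := by simp
  op_univ := by simpa using hsum
  hasSum_iUnion B _ hd ψ := by
    simp only [_root_.sum_apply]
    refine hasSum_sum fun k _ => ?_
    by_cases h : y k ∈ ⋃ n, B n
    · obtain ⟨n, hn⟩ := Set.mem_iUnion.1 h
      rw [Set.indicator_of_mem h]
      have h1 := hasSum_single (f := fun b => ((B b).indicator (fun _ => E k) (y k)) ψ) n (by
        intro b hb
        have : y k ∉ B b := fun hk => (Set.disjoint_left.1 (hd hb)) hk hn
        simp [this])
      simpa [hn] using h1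
    · rw [Set.indicator_of_notMem h]
      have h1 : ∀ n, y k ∉ B n := fun n hn => h (Set.mem_iUnion.2 ⟨n, hn⟩)
      simp [h1, hasSum_zero]

theorem Measurement.law_ofFintype {E : ι → H →L[ℂ] H} (hE : ∀ k, (E k).IsPositive)
    (hsum : ∑ k, E k = 1) (y : ι → Ω) (ψ : H) :
    (Measurement.ofFintype E hE hsum y).law ψ
      = ∑ k, ENNReal.ofReal (⟪ψ, E k ψ⟫_ℂ).re • Measure.dirac (y k) := by
  ext B hB
  rw [Measurement.law_apply _ _ hB, Measure.finsetSum_apply]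
  simp only [ofFintype, _root_.sum_apply, inner_sum, Complex.re_sum, Measure.smul_apply,
    Measure.dirac_apply' _ hB, smul_eq_mul]
  rw [ENNReal.ofReal_sum_of_nonneg]
  · refine Finset.sum_congr rfl fun k _ => ?_
    by_cases h : y k ∈ B <;> simp [h]
  · intro k _
    by_cases h : y k ∈ B
    · simpa [h] using (hE k).re_inner_nonneg_right ψ
    · simp [h]

theorem Measurement.integral_law_ofFintype [MeasurableSingletonClass Ω] {E : ι → H →L[ℂ] H}
    (hE : ∀ k, (E k).IsPositive) (hsum : ∑ k, E k = 1) (y : ι → Ω) (ψ : H) (f : Ω → ℝ) :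
    ∫ x, f x ∂((Measurement.ofFintype E hE hsum y).law ψ)
      = ∑ k, (⟪ψ, E k ψ⟫_ℂ).re * f (y k) := by
  rw [law_ofFintype, integral_finsetSum_measure]
  · refine Finset.sum_congr rfl fun k _ => ?_
    rw [integral_smul_measure, integral_dirac,
      ENNReal.toReal_ofReal (show 0 ≤ (⟪ψ, E k ψ⟫_ℂ).re from (hE k).re_inner_nonneg_right ψ),
      smul_eq_mul]
  · intro k _
    exact (integrable_dirac (by simp)).smul_measure ENNReal.ofReal_ne_top

theorem Measurement.lintegral_law_ofFintype_le [MeasurableSingletonClass Ω] {E : ι → H →L[ℂ] H}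
    (hE : ∀ k, (E k).IsPositive) (hsum : ∑ k, E k = 1) (y : ι → Ω) {ψ : H} (hψ : ‖ψ‖ = 1)
    (f : Ω → ℝ≥0) :
    ∫⁻ x, f x ∂((Measurement.ofFintype E hE hsum y).law ψ) ≤ (∑ k, f (y k) : ℝ≥0) := by
  have hs : ∑ k, (⟪ψ, E k ψ⟫_ℂ).re = 1 := by
    rw [← Complex.re_sum, ← inner_sum, ← _root_.sum_apply, hsum, one_apply_eq_self,
      inner_self_eq_norm_sq_to_K, hψ]
    simp
  rw [law_ofFintype, lintegral_finsetSum_measure]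
  push_cast
  refine Finset.sum_le_sum fun k _ => ?_
  rw [lintegral_smul_measure, lintegral_dirac, smul_eq_mul]
  have h1 : (⟪ψ, E k ψ⟫_ℂ).re ≤ 1 := hs ▸ Finset.single_le_sum
    (f := fun k => (⟪ψ, E k ψ⟫_ℂ).re) (fun k _ => (hE k).re_inner_nonneg_right ψ)
    (Finset.mem_univ k)
  calc ENNReal.ofReal (⟪ψ, E k ψ⟫_ℂ).re * (f (y k) : ℝ≥0∞) ≤ 1 * (f (y k) : ℝ≥0∞) := by
        gcongr
        exact ENNReal.ofReal_le_one.2 h1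
    _ = f (y k) := one_mul _

/-- A family of vectors whose synthesis operator `c ↦ ∑ c_k v_k` is a contraction. -/
def IsContractive (v : ι → H) : Prop :=
  ∀ c : ι → ℂ, ‖∑ k, c k • v k‖ ^ 2 ≤ ∑ k, ‖c k‖ ^ 2

/-- Bessel's inequality: the adjoint of a contraction is a contraction. It is what makes the
complementary operator in `frameOp` positive. -/
theorem IsContractive.sum_norm_inner_sq_le {v : ι → H} (hv : IsContractive v) (w : H) :
    ∑ k, ‖⟪v k, w⟫_ℂ‖ ^ 2 ≤ ‖w‖ ^ 2 := by
  set S : ℝ := ∑ k, ‖⟪v k, w⟫_ℂ‖ ^ 2 with hS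
  set u : H := ∑ k, ⟪v k, w⟫_ℂ • v k with hu
  have h0 : 0 ≤ S := Finset.sum_nonneg fun k _ => by positivity
  have h1 : ‖u‖ ^ 2 ≤ S := hv _
  have h2 : ⟪u, w⟫_ℂ = (S : ℂ) := by
    rw [hu, hS, sum_inner]
    push_cast
    refine Finset.sum_congr rfl fun k _ => ?_
    rw [inner_smul_left, ← Complex.normSq_eq_conj_mul_self, Complex.normSq_eq_norm_sq]
    push_cast
    rfl
  have h3 : S ≤ ‖u‖ * ‖w‖ := by
    have := norm_inner_le_norm (𝕜 := ℂ) u w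
    rwa [h2, Complex.norm_real, Real.norm_eq_abs, abs_of_nonneg h0] at this
  nlinarith [sq_nonneg (‖u‖ - ‖w‖)]

/-- The operators `|v_k⟩⟨v_k|` of a contractive family and their complement. -/
noncomputable def frameOp (v : ι → H) : Option ι → H →L[ℂ] H
  | none => 1 - ∑ k, InnerProductSpace.rankOne ℂ (v k) (v k)
  | some k => InnerProductSpace.rankOne ℂ (v k) (v k)

theorem sum_frameOp (v : ι → H) : ∑ k, frameOp v k = 1 := by
  simp [Fintype.sum_option, frameOp]

theorem re_inner_frameOp_some (v : ι → H) (k : ι) (ψ : H) :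
    (⟪ψ, frameOp v (some k) ψ⟫_ℂ).re = ‖⟪v k, ψ⟫_ℂ‖ ^ 2 := by
  rw [frameOp, InnerProductSpace.rankOne_apply, inner_smul_right, ← inner_conj_symm ψ,
    Complex.mul_conj, Complex.ofReal_re, Complex.normSq_eq_norm_sq]

theorem re_inner_frameOp_none (v : ι → H) (ψ : H) :
    (⟪ψ, frameOp v none ψ⟫_ℂ).re = ‖ψ‖ ^ 2 - ∑ k, ‖⟪v k, ψ⟫_ℂ‖ ^ 2 := by
  simp only [← re_inner_frameOp_some]
  simp only [frameOp, _root_.sub_apply, _root_.sum_apply, inner_sub_right, inner_sum,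
    Complex.sub_re, Complex.re_sum, one_apply_eq_self]
  congr 1
  exact inner_self_eq_norm_sq (𝕜 := ℂ) ψ

theorem IsContractive.isPositive_frameOp {v : ι → H} (hv : IsContractive v) (k : Option ι) :
    (frameOp v k).IsPositive := by
  cases k with
  | some k => exact InnerProductSpace.isPositive_rankOne_self _
  | none =>
    have hs : ((frameOp v none : H →L[ℂ] H) : H →ₗ[ℂ] H).IsSymmetric := by
      intro a b
      simp [frameOp, inner_sub_left, inner_sub_right, inner_sum, sum_inner, inner_smul_left,
        inner_smul_right, mul_comm]
    refine ⟨hs, fun ψ => ?_⟩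
    have h1 := re_inner_frameOp_none v ψ
    have h2 := hv.sum_norm_inner_sq_le ψ
    have h3 : (frameOp v none).reApplyInnerSelf ψ = (⟪ψ, frameOp v none ψ⟫_ℂ).re := by
      rw [ContinuousLinearMap.reApplyInnerSelf_apply]
      exact congrArg Complex.re (hs ψ ψ)
    rw [h3, h1]
    linarith

end FiniteMeasurement

/-! ### Realizing estimation vectors by a measurement -/

section Sufficiency

variable {H : Type*} [NormedAddCommGroup H] [InnerProductSpace ℂ H] {m : ℕ}

namespace PureStateModel

variable (𝓜 : PureStateModel H m) {θ : Fin m → ℝ}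

/-- The rank-one operators |v_k⟩⟨v_k| report θ + d_k. As the amplitudes ⟨v_k|φ⟩ = o_k are real, the
derivative of the k-th probability along ∂_i is 2 o_k Re⟨v_k|∂_i φ⟩; summed with weights d_k this is
Re⟨l_i|x_j⟩. -/
theorem mem_covSet_of_isContractive (hθ : θ ∈ 𝓜.Θ) {ι : Type*} [Fintype ι] {v : ι → H}
    (hv : IsContractive v) {d : ι → Fin m → ℝ} {o : ι → ℝ} {x : Fin m → H}
    (ho : ∀ k, ⟪v k, 𝓜.φ θ⟫_ℂ = o k)
    (hx : ∀ j, ∑ k, ((d k j * o k : ℝ) : ℂ) • v k = x j)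
    (hx0 : ∀ j, ⟪𝓜.φ θ, x j⟫_ℂ = 0)
    (hxl : ∀ i j, (⟪horizontalLift 𝓜.φ θ i, x j⟫_ℂ).re = if i = j then 1 else 0)
    {V : Matrix (Fin m) (Fin m) ℝ} (hV : ∀ i j, V i j = ∑ k, d k i * d k j * o k ^ 2) :
    V ∈ 𝓜.covSet θ := by
  -- The complementary outcome reports θ itself, so it adds nothing to the deviation from θ or to
  -- the covariance.
  set y : Option ι → Fin m → ℝ := fun k => k.elim θ (fun k => θ + d k) with hy
  set M := Measurement.ofFintype (frameOp v) hv.isPositive_frameOp (sum_frameOp v) y with hM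
  have hφ := 𝓜.norm_eq_one θ hθ
  have hmean : ∀ θ' j, 𝓜.mean θ' M j
      = ‖𝓜.φ θ'‖ ^ 2 * θ j + ∑ k, d k j * ‖⟪v k, 𝓜.φ θ'⟫_ℂ‖ ^ 2 := by
    intro θ' j
    rw [mean, hM, Measurement.integral_law_ofFintype _ _ _ _ (fun x : Fin m → ℝ => x j),
      Fintype.sum_option,
      re_inner_frameOp_none]
    simp only [re_inner_frameOp_some, hy, Option.elim, Pi.add_apply, mul_add,
      Finset.sum_add_distrib, sub_mul, Finset.sum_mul]
    have : ∀ k, ‖⟪v k, 𝓜.φ θ'⟫_ℂ‖ ^ 2 * d k j = d k j * ‖⟪v k, 𝓜.φ θ'⟫_ℂ‖ ^ 2 :=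
      fun k => mul_comm _ _
    simp only [this]
    ring
  have hder : ∀ i j, ∑ k, d k j * (2 * (o k * (⟪v k, partialDeriv 𝓜.φ θ i⟫_ℂ).re))
      = if i = j then 1 else 0 := by
    intro i j
    rw [← hxl i j, 𝓜.re_inner_horizontalLift (hx0 j), ← hx j, inner_sum, Complex.re_sum,
      Finset.mul_sum]
    refine Finset.sum_congr rfl fun k _ => ?_
    rw [inner_smul_right, Complex.re_ofReal_mul, ← inner_conj_symm (partialDeriv 𝓜.φ θ i),
      Complex.conj_re]
    ring
  refine ⟨M, ⟨?_, ?_, ?_⟩, ?_⟩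
  · refine ⟨∑ k, ‖y k‖₊ ^ 2, ?_⟩
    filter_upwards [𝓜.isOpen_Θ.mem_nhds hθ] with θ' hθ'
    have := Measurement.lintegral_law_ofFintype_le hv.isPositive_frameOp (sum_frameOp v) y
      (𝓜.norm_eq_one θ' hθ') (fun x => ‖x‖₊ ^ 2)
    simpa [enorm_eq_nnnorm] using this
  · intro j
    rw [hmean, hφ]
    have h1 : ⟪𝓜.φ θ, x j⟫_ℂ = ((∑ k, d k j * ‖⟪v k, 𝓜.φ θ⟫_ℂ‖ ^ 2 : ℝ) : ℂ) := by
      rw [← hx j, inner_sum]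
      push_cast
      refine Finset.sum_congr rfl fun k _ => ?_
      rw [inner_smul_right, ← inner_conj_symm (𝓜.φ θ), ho, Complex.conj_ofReal]
      have : ((‖(o k : ℂ)‖ : ℝ) : ℂ) ^ 2 = (o k : ℂ) ^ 2 := by
        rw [Complex.norm_real, Real.norm_eq_abs]
        exact_mod_cast sq_abs (o k)
      rw [this]
      ring
    rw [hx0 j] at h1
    have h2 : ∑ k, d k j * ‖⟪v k, 𝓜.φ θ⟫_ℂ‖ ^ 2 = 0 := by exact_mod_cast h1.symm
    rw [h2]
    ring
  · intro i j
    rw [← hder i j]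
    have h1 : HasDerivAt (fun t : ℝ => θ j + ∑ k, d k j *
        ‖⟪v k, 𝓜.φ (θ + t • (Pi.single i 1 : Fin m → ℝ))⟫_ℂ‖ ^ 2)
        (∑ k, d k j * (2 * (o k * (⟪v k, partialDeriv 𝓜.φ θ i⟫_ℂ).re))) 0 := by
      refine (HasDerivAt.fun_sum fun k _ => HasDerivAt.const_mul _ ?_).const_add _
      have h2 := ((hasDerivAt_const (0 : ℝ) (v k)).inner ℂ (𝓜.hasDerivAt_state hθ i)).norm_sq
      refine h2.congr_deriv ?_
      simp [ho, Complex.inner, mul_comm]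
    refine h1.congr_of_eventuallyEq ?_
    filter_upwards [𝓜.eventually_norm_eq_one hθ i] with t ht
    rw [hmean, ht]
    ring
  · ext i j
    rw [hV, cov, Matrix.of_apply, hM, Measurement.integral_law_ofFintype _ _ _ _
      (fun x : Fin m → ℝ => (x i - θ i) * (x j - θ j)), Fintype.sum_option]
    simp only [hy, Option.elim, sub_self, mul_zero, zero_add, re_inner_frameOp_some, Pi.add_apply,
      add_sub_cancel_left, ho, Complex.norm_real, Real.norm_eq_abs, sq_abs]
    exact Finset.sum_congr rfl fun k _ => by ring

end PureStateModel

theorem hermForm_fin_two (V : Matrix (Fin 2) (Fin 2) ℝ) (hV : V 1 0 = V 0 1) (c : Fin 2 → ℂ) :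
    hermForm V c = V 0 0 * ‖c 0‖ ^ 2 + V 1 1 * ‖c 1‖ ^ 2
      + 2 * V 0 1 * ((c 0).re * (c 1).re + (c 0).im * (c 1).im) := by
  simp only [hermForm, Fin.sum_univ_two, hV, ← Complex.normSq_eq_norm_sq, Complex.normSq_apply,
    Complex.mul_re, Complex.conj_re, Complex.conj_im]
  ring

/-- The coefficients form the Householder reflection 1 - (2/3)J, with J the all-ones matrix; an
orthogonal change of coefficients preserves contractivity. None of its entries vanishes, so every
new vector overlaps φ when φ is the first of the frame. -/
theorem isContractive_reflect {f : Fin 3 → H} (hf : IsContractive f) :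
    IsContractive (fun k : Fin 3 => ∑ a, (((if k = a then 1 / 3 else -(2 / 3)) : ℝ) : ℂ) • f a) := by
  intro c
  have h1 : ∑ k, c k • ∑ a, (((if k = a then 1 / 3 else -(2 / 3)) : ℝ) : ℂ) • f a
      = ∑ a, (∑ k, c k * (((if k = a then 1 / 3 else -(2 / 3)) : ℝ) : ℂ)) • f a := by
    simp only [Finset.smul_sum, Finset.sum_smul, mul_smul]
    exact Finset.sum_comm
  rw [h1]
  refine (hf _).trans_eq ?_
  simp only [Fin.sum_univ_three, ← Complex.normSq_eq_norm_sq, Complex.normSq_apply]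
  simp
  ring

namespace PureStateModel

variable (𝓜 : PureStateModel H 2) {θ : Fin 2 → ℝ}

/-- A Cholesky factorization V = LLᵀ gives x = Lg with g contractive; adjoining φ keeps
contractivity by orthogonality. After reflection, outcomes d_k can be chosen to reproduce both x and
V. -/
theorem mem_covSet_of_estimationVectors (hθ : θ ∈ 𝓜.Θ) {V : Matrix (Fin 2) (Fin 2) ℝ}
    (hV : V 1 0 = V 0 1) {x : Fin 2 → H} (hx0 : ∀ j, ⟪𝓜.φ θ, x j⟫_ℂ = 0)
    (hxl : ∀ i j, (⟪horizontalLift 𝓜.φ θ i, x j⟫_ℂ).re = if i = j then 1 else 0)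
    (hx : ∀ c : Fin 2 → ℂ, ‖∑ j, c j • x j‖ ^ 2 ≤ hermForm V c) : V ∈ 𝓜.covSet θ := by
  -- V is positive definite: biorthogonality makes x_0, x_1 independent over ℝ.
  have hne : ∀ r s : ℝ, (r ≠ 0 ∨ s ≠ 0) →
      0 < V 0 0 * r ^ 2 + V 1 1 * s ^ 2 + 2 * V 0 1 * (r * s) := by
    intro r s hrs
    have h1 := hx ![(r : ℂ), (s : ℂ)]
    rw [hermForm_fin_two V hV] at h1
    simp only [Fin.sum_univ_two, Matrix.cons_val_zero, Matrix.cons_val_one, Complex.norm_real,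
      Real.norm_eq_abs, sq_abs, Complex.ofReal_re, Complex.ofReal_im, mul_zero, add_zero] at h1
    refine lt_of_lt_of_le ?_ h1
    have h2 : (r : ℂ) • x 0 + (s : ℂ) • x 1 ≠ 0 := by
      intro h
      have h3 : ∀ i, (⟪horizontalLift 𝓜.φ θ i, (r : ℂ) • x 0 + (s : ℂ) • x 1⟫_ℂ).re = 0 := by
        intro i; rw [h]; simp
      simp only [inner_add_right, inner_smul_right, Complex.add_re, Complex.re_ofReal_mul,
        hxl] at h3
      have h4 := h3 0
      have h5 := h3 1
      simp at h4 h5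
      exact hrs.elim (· h4) (· h5)
    have := norm_pos_iff.2 h2
    positivity
  have hV0 : 0 < V 0 0 := by simpa using hne 1 0 (by simp)
  have hdet : 0 < V 0 0 * V 1 1 - V 0 1 ^ 2 := by
    have h1 := hne (-V 0 1) (V 0 0) (Or.inr hV0.ne')
    have h2 : 0 < V 0 0 * (V 0 0 * V 1 1 - V 0 1 ^ 2) := by
      refine h1.trans_eq ?_; ring
    exact pos_of_mul_pos_right h2 hV0.le
  obtain ⟨a, ha, ha2⟩ : ∃ a : ℝ, 0 < a ∧ V 0 0 = a ^ 2 :=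
    ⟨√(V 0 0), Real.sqrt_pos.2 hV0, (Real.sq_sqrt hV0.le).symm⟩
  obtain ⟨e, he⟩ : ∃ e : ℝ, V 0 1 = a * e := ⟨V 0 1 / a, by field_simp⟩
  obtain ⟨f, hf, hf2⟩ : ∃ f : ℝ, 0 < f ∧ V 1 1 = e ^ 2 + f ^ 2 := by
    have h1 : 0 < V 1 1 - e ^ 2 := by
      rw [ha2, he] at hdet
      have h2 : 0 < a ^ 2 * (V 1 1 - e ^ 2) := by refine hdet.trans_eq ?_; ring
      exact pos_of_mul_pos_right h2 (by positivity)
    exact ⟨√(V 1 1 - e ^ 2), Real.sqrt_pos.2 h1, by rw [Real.sq_sqrt h1.le]; ring⟩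
  have haC : (a : ℂ) ≠ 0 := by exact_mod_cast ha.ne'
  have hfC : (f : ℂ) ≠ 0 := by exact_mod_cast hf.ne'
  obtain ⟨g0, hg0⟩ : ∃ g0 : H, g0 = (a : ℂ)⁻¹ • x 0 := ⟨_, rfl⟩
  obtain ⟨g1, hg1⟩ : ∃ g1 : H, g1 = (f : ℂ)⁻¹ • (x 1 - (e : ℂ) • g0) := ⟨_, rfl⟩
  have hx0' : x 0 = (a : ℂ) • g0 := by rw [hg0, smul_inv_smul₀ haC]
  have hx1' : x 1 = (e : ℂ) • g0 + (f : ℂ) • g1 := by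
    rw [hg1, smul_inv_smul₀ hfC]; abel
  have hφg0 : ⟪𝓜.φ θ, g0⟫_ℂ = 0 := by rw [hg0, inner_smul_right, hx0, mul_zero]
  have hφg1 : ⟪𝓜.φ θ, g1⟫_ℂ = 0 := by
    rw [hg1, inner_smul_right, inner_sub_right, inner_smul_right, hx0, hφg0]; simp
  have hφ : ⟪𝓜.φ θ, 𝓜.φ θ⟫_ℂ = 1 := by
    rw [inner_self_eq_norm_sq_to_K, 𝓜.norm_eq_one θ hθ]; simp
  have hg : ∀ c d : ℂ, ‖c • g0 + d • g1‖ ^ 2 ≤ ‖c‖ ^ 2 + ‖d‖ ^ 2 := by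
    intro c d
    -- These coefficients solve Lᵀp = (c, d) for L = [[a, 0], [e, f]].
    have h1 := hx ![(c - e * (d / f)) / a, d / f]
    rw [hermForm_fin_two V hV, ha2, he, hf2] at h1
    simp only [Fin.sum_univ_two, Matrix.cons_val_zero, Matrix.cons_val_one] at h1
    have h2 : ((c - e * (d / f)) / a) • x 0 + (d / f) • x 1 = c • g0 + d • g1 := by
      rw [hx0', hx1', smul_add, smul_smul, smul_smul, smul_smul, div_mul_cancel₀ _ haC,
        div_mul_cancel₀ _ hfC, ← add_assoc, ← add_smul]
      congr 2
      ring
    rw [h2] at h1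
    refine h1.trans_eq ?_
    have h3 : ∀ p q : ℂ, a ^ 2 * ‖p‖ ^ 2 + (e ^ 2 + f ^ 2) * ‖q‖ ^ 2
        + 2 * (a * e) * (p.re * q.re + p.im * q.im) = ‖a * p + e * q‖ ^ 2 + ‖f * q‖ ^ 2 := by
      intro p q
      simp only [← Complex.normSq_eq_norm_sq, Complex.normSq_apply, Complex.add_re, Complex.add_im,
        Complex.re_ofReal_mul, Complex.im_ofReal_mul]
      ring
    rw [h3, mul_div_cancel₀ _ haC, mul_div_cancel₀ _ hfC, sub_add_cancel]
  have hfr : IsContractive ![𝓜.φ θ, g0, g1] := by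
    intro c
    simp only [Fin.sum_univ_three, Matrix.cons_val_zero, Matrix.cons_val_one, Matrix.cons_val]
    rw [add_assoc, add_assoc]
    have h1 : ⟪c 0 • 𝓜.φ θ, c 1 • g0 + c 2 • g1⟫_ℂ = 0 := by
      simp only [inner_smul_left, inner_add_right, inner_smul_right, hφg0, hφg1, mul_zero, add_zero]
    have h2 := norm_add_sq_eq_norm_sq_add_norm_sq_of_inner_eq_zero _ _ h1
    rw [sq, h2, norm_smul, 𝓜.norm_eq_one θ hθ]
    have := hg (c 1) (c 2)
    nlinarith
  -- With R the reflection, o_k = R_k0, and d_k is (a R_k1, e R_k1 + f R_k2) divided by R_k0.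
  -- Orthogonality of R then yields ∑ d_k o_k v_k = x and ∑ d_k d_kᵀ o_k² = LLᵀ.
  refine 𝓜.mem_covSet_of_isContractive hθ (isContractive_reflect hfr)
    (d := ![![-2 * a, -2 * e - 2 * f], ![-a / 2, -e / 2 + f], ![a, e - f / 2]])
    (o := ![1 / 3, -(2 / 3), -(2 / 3)]) (x := x) ?_ ?_ hx0 hxl ?_
  · have hg0φ : ⟪g0, 𝓜.φ θ⟫_ℂ = 0 := by rw [← inner_conj_symm, hφg0, map_zero]
    have hg1φ : ⟪g1, 𝓜.φ θ⟫_ℂ = 0 := by rw [← inner_conj_symm, hφg1, map_zero]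
    intro k
    simp only [Fin.sum_univ_three, inner_add_left, inner_smul_left, Matrix.cons_val_zero,
      Matrix.cons_val_one, Matrix.cons_val, hφ, hg0φ, hg1φ, Complex.conj_ofReal, mul_one,
      mul_zero, add_zero]
    fin_cases k <;> simp
  · intro j
    fin_cases j
    · simp [Fin.sum_univ_three, hx0']
      module
    · simp [Fin.sum_univ_three, hx1']
      module
  · intro i j
    fin_cases i <;> fin_cases j <;> simp [Fin.sum_univ_three, ha2, he, hf2, hV] <;> ring

end PureStateModel

end Sufficiency

/-! ### The matrix inequality in the plane and the explicit region -/

section PlaneGeometry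

/-- The inequality `W ≥ P Pᵀ - i s ε` with `s = γ (p₂ - p₁) + b (1 - det P)`, `γ = (1 - b²)^{1/2}`,
solvable for a real matrix `P = [[p₀, p₁], [p₂, p₃]]`, where `W = [[w₀, w₁], [w₁, w₂]]`. -/
def PlaneDominates (b w0 w1 w2 : ℝ) : Prop :=
  ∃ p0 p1 p2 p3 : ℝ, 0 ≤ w0 - p0 ^ 2 - p1 ^ 2 ∧ 0 ≤ w2 - p2 ^ 2 - p3 ^ 2 ∧
    (w1 - p0 * p2 - p1 * p3) ^ 2 + (√(1 - b ^ 2) * (p2 - p1) + b * (1 - (p0 * p3 - p1 * p2))) ^ 2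
      ≤ (w0 - p0 ^ 2 - p1 ^ 2) * (w2 - p2 ^ 2 - p3 ^ 2)

/-- The explicit form of `PlaneDominates`, through `det W` and `tr W`. -/
def PlaneRegion (b w0 w1 w2 : ℝ) : Prop :=
  0 ≤ w0 + w2 ∧ 0 ≤ w0 * w2 - w1 ^ 2 ∧
    |b| ≤ |b| * √(w0 * w2 - w1 ^ 2)
      + √(1 - b ^ 2) * √(w0 + w2 + 2 * √(w0 * w2 - w1 ^ 2))

/-- By Cayley–Hamilton, √W = (W + d)/τ with d = √det W and τ = √(tr W + 2d); if τ = 0 then W = 0. -/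
theorem exists_symmetric_sqrt {w0 w1 w2 : ℝ} (htr : 0 ≤ w0 + w2) (hdet : 0 ≤ w0 * w2 - w1 ^ 2) :
    ∃ h0 h1 h2 : ℝ, h0 ^ 2 + h1 ^ 2 = w0 ∧ h1 ^ 2 + h2 ^ 2 = w2 ∧ h1 * (h0 + h2) = w1 ∧
      h0 * h2 - h1 ^ 2 = √(w0 * w2 - w1 ^ 2) ∧
      h0 + h2 = √(w0 + w2 + 2 * √(w0 * w2 - w1 ^ 2)) := by
  set d := √(w0 * w2 - w1 ^ 2) with hd
  have hd0 : 0 ≤ d := Real.sqrt_nonneg _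
  have hd2 : d ^ 2 = w0 * w2 - w1 ^ 2 := Real.sq_sqrt hdet
  set τ := √(w0 + w2 + 2 * d) with hτ
  have hτ2 : τ ^ 2 = w0 + w2 + 2 * d := Real.sq_sqrt (by linarith)
  have hτ0 : 0 ≤ τ := Real.sqrt_nonneg _
  rcases hτ0.eq_or_lt with h | h
  · rw [← h] at hτ2
    have hd' : d = 0 := by nlinarith
    have ht : w2 = -w0 := by nlinarith
    rw [hd', ht] at hd2
    have h0 : w0 = 0 := by nlinarith [sq_nonneg w0, sq_nonneg w1]
    have h1 : w1 = 0 := by nlinarith [sq_nonneg w0, sq_nonneg w1]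
    refine ⟨0, 0, 0, ?_, ?_, ?_, ?_, ?_⟩ <;> simp [h0, h1, ht, hd', ← h]
  · have hτne : τ ≠ 0 := h.ne'
    refine ⟨(w0 + d) / τ, w1 / τ, (w2 + d) / τ, ?_, ?_, ?_, ?_, ?_⟩ <;> field_simp
    · rw [hτ2]; linear_combination hd2
    · rw [hτ2]; linear_combination hd2
    · rw [hτ2]; ring
    · rw [hτ2]; linear_combination -hd2
    · rw [hτ2]; ring

theorem PlaneRegion.planeDominates {b w0 w1 w2 : ℝ} (h : PlaneRegion b w0 w1 w2) :
    PlaneDominates b w0 w1 w2 := by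
  obtain ⟨htr, hdet, hle⟩ := h
  obtain ⟨h0, h1, h2, e0, e2, e1, ed, eτ⟩ := exists_symmetric_sqrt htr hdet
  rw [← eτ, ← ed] at hle
  have hd0 : 0 ≤ h0 * h2 - h1 ^ 2 := ed ▸ Real.sqrt_nonneg _
  set γ := √(1 - b ^ 2)
  subst e0 e1 e2
  rcases le_total 1 (h0 * h2 - h1 ^ 2) with hd | hd
  -- P = c√W with det P = 1 is symmetric, so s = 0 and W - PPᵀ = (1 - c²)W.
  · obtain ⟨c, hc1, hc⟩ : ∃ c : ℝ, c ^ 2 ≤ 1 ∧ c ^ 2 * (h0 * h2 - h1 ^ 2) = 1 := by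
      refine ⟨√((h0 * h2 - h1 ^ 2)⁻¹), ?_, ?_⟩
      · rw [Real.sq_sqrt (by positivity)]; exact inv_le_one_of_one_le₀ hd
      · rw [Real.sq_sqrt (by positivity)]; exact inv_mul_cancel₀ (by linarith)
    refine ⟨c * h0, c * h1, c * h1, c * h2, ?_, ?_, ?_⟩
    · nlinarith [sq_nonneg h0, sq_nonneg h1]
    · nlinarith [sq_nonneg h2, sq_nonneg h1]
    · have hs : γ * (c * h1 - c * h1) + b * (1 - (c * h0 * (c * h2) - c * h1 * (c * h1))) = 0 := by
        linear_combination -b * hc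
      rw [hs]
      nlinarith [mul_nonneg (sq_nonneg (1 - c ^ 2)) (sq_nonneg (h0 * h2 - h1 ^ 2))]
  · have hy : |b * (1 - (h0 * h2 - h1 ^ 2))| ≤ γ * (h0 + h2) := by
      rw [abs_mul, abs_of_nonneg (sub_nonneg.2 hd)]
      linarith
    -- Here s is the sine of the angle in P = √W R. Then PPᵀ = W and p₂ - p₁ = -s tr √W, so the
    -- hypothesis is exactly the solvability of s γ tr √W = b(1 - det √W).
    obtain ⟨s, hs1, hs⟩ : ∃ s : ℝ, |s| ≤ 1 ∧
        γ * (h0 + h2) * s = b * (1 - (h0 * h2 - h1 ^ 2)) := by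
      generalize γ * (h0 + h2) = t at hy
      generalize b * (1 - (h0 * h2 - h1 ^ 2)) = y at hy
      rcases (le_trans (abs_nonneg _) hy).eq_or_lt with ht | ht
      · refine ⟨0, by simp, ?_⟩
        rw [← ht] at hy
        rw [mul_zero, abs_eq_zero.1 (le_antisymm hy (abs_nonneg _))]
      · exact ⟨y / t, by rw [abs_div, abs_of_pos ht, div_le_one ht]; exact hy,
          mul_div_cancel₀ _ ht.ne'⟩
    obtain ⟨c, hc⟩ : ∃ c : ℝ, c ^ 2 = 1 - s ^ 2 :=
      ⟨√(1 - s ^ 2), Real.sq_sqrt (by nlinarith [(sq_le_one_iff_abs_le_one s).2 hs1])⟩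
    have k0 : h0 ^ 2 + h1 ^ 2 - (h0 * c - h1 * s) ^ 2 - (h0 * s + h1 * c) ^ 2 = 0 := by
      linear_combination -(h0 ^ 2 + h1 ^ 2) * hc
    have k2 : h1 ^ 2 + h2 ^ 2 - (h1 * c - h2 * s) ^ 2 - (h1 * s + h2 * c) ^ 2 = 0 := by
      linear_combination -(h1 ^ 2 + h2 ^ 2) * hc
    refine ⟨h0 * c - h1 * s, h0 * s + h1 * c, h1 * c - h2 * s, h1 * s + h2 * c, k0.ge, k2.ge, ?_⟩
    rw [k0, k2]
    have k1 : h1 * (h0 + h2) - (h0 * c - h1 * s) * (h1 * c - h2 * s)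
        - (h0 * s + h1 * c) * (h1 * s + h2 * c) = 0 := by
      linear_combination -(h1 * (h0 + h2)) * hc
    have k3 : γ * (h1 * c - h2 * s - (h0 * s + h1 * c))
        + b * (1 - ((h0 * c - h1 * s) * (h1 * s + h2 * c)
          - (h0 * s + h1 * c) * (h1 * c - h2 * s))) = 0 := by
      linear_combination -hs - b * (h0 * h2 - h1 ^ 2) * hc
    rw [k1, k3]
    simp

/-- Bound for the mixed determinant of two positive 2×2 matrices by twice the geometric mean of
their determinants: Cauchy–Schwarz, then arithmetic–geometric mean. -/
theorem two_mul_abs_le_mixed {D0 D1 D2 s a f e g : ℝ} (hD0 : 0 ≤ D0) (hD2 : 0 ≤ D2)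
    (ha : 0 ≤ a) (he : 0 ≤ e) (hD : D1 ^ 2 + s ^ 2 ≤ D0 * D2) (hf : f ^ 2 + g ^ 2 = a * e) :
    2 * (|g| * |s|) ≤ D0 * e + D2 * a - 2 * (D1 * f) := by
  have h1 : (2 * (|D1| * |f| + |s| * |g|)) ^ 2 ≤ (D0 * e + D2 * a) ^ 2 := by
    have h2 : (|D1| * |f| + |s| * |g|) ^ 2 ≤ (D1 ^ 2 + s ^ 2) * (f ^ 2 + g ^ 2) := by
      rw [← sq_abs D1, ← sq_abs s, ← sq_abs f, ← sq_abs g]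
      nlinarith [sq_nonneg (|D1| * |g| - |s| * |f|)]
    have h3 : (D1 ^ 2 + s ^ 2) * (f ^ 2 + g ^ 2) ≤ D0 * D2 * (a * e) := by
      rw [hf]
      exact mul_le_mul_of_nonneg_right hD (by positivity)
    nlinarith [sq_nonneg (D0 * e - D2 * a)]
  have h4 := (pow_le_pow_iff_left₀ (by positivity) (by positivity) two_ne_zero).1 h1
  have h5 : D1 * f ≤ |D1| * |f| := by rw [← abs_mul]; exact le_abs_self _
  linarith

/-- With D = W - PPᵀ and g = det P, the mixed bound gives √det W ≥ |g| + |s|, and then τ² ≥ (p₂ -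
p₁)² + 4|s|. The definition of s gives |b| ≤ |b||g| + |s| + γ|p₂ - p₁|, and the excess (1 - |b|)|s|
is absorbed into γτ. -/
theorem PlaneDominates.planeRegion {b w0 w1 w2 : ℝ} (hb : b ^ 2 ≤ 1)
    (h : PlaneDominates b w0 w1 w2) : PlaneRegion b w0 w1 w2 := by
  obtain ⟨p0, p1, p2, p3, hD0, hD2, hD⟩ := h
  set γ := √(1 - b ^ 2) with hγ
  have hγ0 : 0 ≤ γ := Real.sqrt_nonneg _
  have hγ2 : γ ^ 2 = 1 - b ^ 2 := Real.sq_sqrt (by linarith)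
  obtain ⟨s, hs⟩ : ∃ s, s = γ * (p2 - p1) + b * (1 - (p0 * p3 - p1 * p2)) := ⟨_, rfl⟩
  obtain ⟨D0, hD0e⟩ : ∃ D0, D0 = w0 - p0 ^ 2 - p1 ^ 2 := ⟨_, rfl⟩
  obtain ⟨D1, hD1e⟩ : ∃ D1, D1 = w1 - p0 * p2 - p1 * p3 := ⟨_, rfl⟩
  obtain ⟨D2, hD2e⟩ : ∃ D2, D2 = w2 - p2 ^ 2 - p3 ^ 2 := ⟨_, rfl⟩
  obtain ⟨g, hg⟩ : ∃ g, g = p0 * p3 - p1 * p2 := ⟨_, rfl⟩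
  rw [← hs, ← hD0e, ← hD1e, ← hD2e] at hD
  rw [← hD0e] at hD0
  rw [← hD2e] at hD2
  have hmix := two_mul_abs_le_mixed (a := p0 ^ 2 + p1 ^ 2) (f := p0 * p2 + p1 * p3)
    (e := p2 ^ 2 + p3 ^ 2) (g := g) hD0 hD2 (by positivity) (by positivity) hD (by rw [hg]; ring)
  have hdet : (|g| + |s|) ^ 2 ≤ w0 * w2 - w1 ^ 2 := by
    have h1 : w0 * w2 - w1 ^ 2 = (D0 * D2 - D1 ^ 2) + g ^ 2 + (D0 * (p2 ^ 2 + p3 ^ 2)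
        + D2 * (p0 ^ 2 + p1 ^ 2) - 2 * (D1 * (p0 * p2 + p1 * p3))) := by
      rw [hD0e, hD1e, hD2e, hg]; ring
    rw [h1, add_sq, sq_abs, sq_abs]
    linarith
  have hdet0 : 0 ≤ w0 * w2 - w1 ^ 2 := le_trans (sq_nonneg _) hdet
  have htr : D0 + D2 + (p0 ^ 2 + p1 ^ 2 + p2 ^ 2 + p3 ^ 2) = w0 + w2 := by
    rw [hD0e, hD2e]; ring
  have htr0 : 0 ≤ w0 + w2 := by rw [← htr]; positivity
  refine ⟨htr0, hdet0, ?_⟩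
  set d := √(w0 * w2 - w1 ^ 2) with hd
  have hdge : |g| + |s| ≤ d := Real.le_sqrt_of_sq_le hdet
  set τ := √(w0 + w2 + 2 * d) with hτ
  have hτ0 : 0 ≤ τ := Real.sqrt_nonneg _
  have hτ2 : τ ^ 2 = w0 + w2 + 2 * d :=
    Real.sq_sqrt (by linarith [Real.sqrt_nonneg (w0 * w2 - w1 ^ 2)])
  have hDs : 2 * |s| ≤ D0 + D2 := by
    refine (pow_le_pow_iff_left₀ (by positivity) (by positivity) two_ne_zero).1 ?_
    rw [mul_pow, sq_abs]
    nlinarith [sq_nonneg (D0 - D2), sq_nonneg D1]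
  obtain ⟨p, hp⟩ : ∃ p, p = |p2 - p1| := ⟨_, rfl⟩
  have hp0 : 0 ≤ p := hp ▸ abs_nonneg _
  have hS0 : 0 ≤ |s| := abs_nonneg s
  have hτge : p ^ 2 + 4 * |s| ≤ τ ^ 2 := by
    rw [hτ2, hp, sq_abs, ← htr]
    have := le_abs_self g
    nlinarith [sq_nonneg (p0 + p3)]
  have hbs : |b| ≤ |b| * |g| + |s| + γ * p := by
    have h1 : b = s + (b * g - γ * (p2 - p1)) := by rw [hs, hg]; ring
    calc |b| = |s + (b * g - γ * (p2 - p1))| := by rw [← h1]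
      _ ≤ |s| + (|b * g| + |γ * (p2 - p1)|) := (abs_add_le _ _).trans (by gcongr; exact abs_sub _ _)
      _ = _ := by rw [abs_mul, abs_mul, abs_of_nonneg hγ0, hp]; ring
  have hb1 : |b| ≤ 1 := (sq_le_one_iff_abs_le_one b).1 hb
  have hb0 : 0 ≤ |b| := abs_nonneg b
  have hγ2' : γ ^ 2 = 1 - |b| ^ 2 := by rw [sq_abs]; exact hγ2
  have hg0 : 0 ≤ |g| := abs_nonneg g
  -- The negated inequality supplies the a priori bounds |s| ≤ 1 and γp ≤ |b| needed to compare
  -- squares in `key`.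
  by_contra! hcon
  have hpτ : p ≤ τ := by
    refine (pow_le_pow_iff_left₀ hp0 hτ0 two_ne_zero).1 ?_
    linarith
  have hd1 : |s| ≤ 1 := by
    by_contra! h1
    have h2 := mul_le_mul_of_nonneg_left (show 1 ≤ d by linarith) hb0
    linarith [mul_nonneg hγ0 hτ0]
  have hγp : γ * p ≤ |b| := by
    have := mul_le_mul_of_nonneg_left hpτ hγ0
    linarith [mul_nonneg hb0 (Real.sqrt_nonneg (w0 * w2 - w1 ^ 2))]
  have key : (1 - |b|) * |s| + γ * p ≤ γ * τ := by
    have h1b : 0 ≤ 1 - |b| := by linarith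
    refine (pow_le_pow_iff_left₀ (by positivity) (by positivity) two_ne_zero).1 ?_
    have h0 : (1 - |b|) * |s| ≤ 1 - |b| := mul_le_of_le_one_right h1b hd1
    have h1 : γ ^ 2 * (p ^ 2 + 4 * |s|) ≤ (γ * τ) ^ 2 := by
      rw [mul_pow]; exact mul_le_mul_of_nonneg_left hτge (by positivity)
    have h2 : ((1 - |b|) * |s|) * ((1 - |b|) * |s|) ≤ ((1 - |b|) * |s|) * (1 - |b|) :=
      mul_le_mul_of_nonneg_left h0 (by positivity)
    have h3 : ((1 - |b|) * |s|) * (γ * p) ≤ ((1 - |b|) * |s|) * |b| :=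
      mul_le_mul_of_nonneg_left hγp (by positivity)
    have h4 : 0 ≤ (1 - |b|) * |s| * (1 + |b|) := by positivity
    have h5 : γ ^ 2 * |s| = (1 - |b|) * |s| * (1 + |b|) := by rw [hγ2']; ring
    have h6 : ((1 - |b|) * |s| + γ * p) ^ 2 = ((1 - |b|) * |s|) * ((1 - |b|) * |s|)
        + 2 * (((1 - |b|) * |s|) * (γ * p)) + γ ^ 2 * p ^ 2 := by ring
    have h7 : γ ^ 2 * (p ^ 2 + 4 * |s|) = γ ^ 2 * p ^ 2 + 4 * ((1 - |b|) * |s| * (1 + |b|)) := by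
      rw [← h5]; ring
    rw [h6]
    refine le_trans ?_ h1
    rw [h7]
    linarith
  have h5 : |b| * (|g| + |s|) ≤ |b| * d := mul_le_mul_of_nonneg_left hdge hb0
  linarith

theorem planeDominates_iff {b w0 w1 w2 : ℝ} (hb : b ^ 2 ≤ 1) :
    PlaneDominates b w0 w1 w2 ↔ PlaneRegion b w0 w1 w2 :=
  ⟨fun h => h.planeRegion hb, fun h => h.planeDominates⟩

theorem sqrt_add_mul_sqrt_sub {m r : ℝ} (hr : 0 ≤ r) (h : r ≤ m) :
    √(m + r) * √(m - r) = √(m ^ 2 - r ^ 2) ∧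
      √(m + r) + √(m - r) = √(2 * m + 2 * √(m ^ 2 - r ^ 2)) := by
  have h1 : √(m + r) * √(m - r) = √(m ^ 2 - r ^ 2) := by
    rw [← Real.sqrt_mul (by linarith)]
    congr 1
    ring
  refine ⟨h1, ?_⟩
  have h2 : 2 * m + 2 * (√(m + r) * √(m - r)) = (√(m + r) + √(m - r)) ^ 2 := by
    rw [add_sq, Real.sq_sqrt (by linarith), Real.sq_sqrt (by linarith)]
    ring
  rw [← h1, h2, Real.sqrt_sq (by positivity)]

theorem mem_normalizedRegion_iff {b : ℝ} {V : Matrix (Fin 2) (Fin 2) ℝ} :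
    V ∈ normalizedRegion b ↔
      V 1 0 = V 0 1 ∧ PlaneRegion b (V 0 0 - 1) (V 0 1) (V 1 1 - 1) := by
  constructor
  · rintro ⟨x, y, z, r, rfl, hr, h1, h2⟩
    have hr0 : 0 ≤ r := hr ▸ Real.sqrt_nonneg _
    have hr2 : r ^ 2 = x ^ 2 + y ^ 2 := by rw [hr, Real.sq_sqrt (by positivity)]
    obtain ⟨e1, e2⟩ := sqrt_add_mul_sqrt_sub (m := z - 1) hr0 (by linarith)
    have e3 : (z + x - 1) * (z - x - 1) - y ^ 2 = (z - 1) ^ 2 - r ^ 2 := by rw [hr2]; ring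
    refine ⟨rfl, ?_⟩
    simp only [PlaneRegion, Matrix.cons_val', Matrix.cons_val_zero, Matrix.cons_val_one,
      Matrix.of_apply, Matrix.cons_val_fin_one]
    rw [e3]
    refine ⟨by linarith, by nlinarith, ?_⟩
    rw [show z + x - 1 + (z - x - 1) = 2 * (z - 1) by ring, ← e2, ← e1, ← mul_assoc,
      show z - 1 + r = z + r - 1 by ring, show z - 1 - r = z - r - 1 by ring]
    exact h2
  · rintro ⟨hs, h1, h2, h3⟩
    set x := (V 0 0 - V 1 1) / 2 with hx
    set z := (V 0 0 + V 1 1) / 2 with hz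
    set y := V 0 1 with hy
    set r := √(x ^ 2 + y ^ 2) with hr
    have hr0 : 0 ≤ r := Real.sqrt_nonneg _
    have hr2 : r ^ 2 = x ^ 2 + y ^ 2 := Real.sq_sqrt (by positivity)
    have e3 : (V 0 0 - 1) * (V 1 1 - 1) - y ^ 2 = (z - 1) ^ 2 - r ^ 2 := by
      rw [hr2, hx, hz]; ring
    have hzr : r ≤ z - 1 := by
      refine (pow_le_pow_iff_left₀ hr0 (by rw [hz]; linarith) two_ne_zero).1 ?_
      rw [e3] at h2
      linarith
    obtain ⟨e1, e2⟩ := sqrt_add_mul_sqrt_sub (m := z - 1) hr0 hzr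
    refine ⟨x, y, z, r, ?_, rfl, by linarith, ?_⟩
    · ext i j
      fin_cases i <;> fin_cases j <;> simp [hx, hz, hs, ← hy] <;> ring
    · rw [e3, show V 0 0 - 1 + (V 1 1 - 1) = 2 * (z - 1) by rw [hz]; ring, ← e2, ← e1, ← mul_assoc,
        show z - 1 + r = z + r - 1 by ring, show z - 1 - r = z - r - 1 by ring] at h3
      exact h3

theorem normalizedRegion_congr {b β : ℝ} (h : b ^ 2 = β ^ 2) :
    normalizedRegion b = normalizedRegion β := by
  simp only [normalizedRegion, (sq_eq_sq_iff_abs_eq_abs _ _).1 h, h]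

/-- The condition reads |β|(1 - d) ≤ √(1 - β²) τ: void for d ≥ 1, and weaker as |β| decreases for d
≤ 1. -/
theorem normalizedRegion_anti {β β' : ℝ} (h : |β'| ≤ |β|) :
    normalizedRegion β ⊆ normalizedRegion β' := by
  rintro V ⟨x, y, z, r, hV, hr, h1, h2⟩
  refine ⟨x, y, z, r, hV, hr, h1, ?_⟩
  have h3 : √(1 - β ^ 2) ≤ √(1 - β' ^ 2) := Real.sqrt_le_sqrt (by linarith [sq_le_sq.2 h])
  rw [mul_assoc] at h2 ⊢
  have ht : 0 ≤ √(z + r - 1) + √(z - r - 1) := by positivity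
  have h4 := mul_le_mul_of_nonneg_right h3 ht
  rcases le_total 1 (√(z + r - 1) * √(z - r - 1)) with h5 | h5
  · have := mul_le_mul_of_nonneg_left h5 (abs_nonneg β')
    have h6 : 0 ≤ √(1 - β' ^ 2) * (√(z + r - 1) + √(z - r - 1)) := by positivity
    linarith
  · have := mul_le_mul_of_nonneg_right h (sub_nonneg.2 h5)
    nlinarith

/-- The least trace on the normalized region. -/
theorem isLeast_trace_normalizedRegion {β : ℝ} (hβ : |β| ≤ 1) :
    IsLeast (Matrix.trace '' normalizedRegion β) (4 / (1 + √(1 - β ^ 2))) := by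
  have hβ2 : β ^ 2 ≤ 1 := (sq_le_one_iff_abs_le_one β).2 hβ
  set γ := √(1 - β ^ 2) with hγ
  have hγ0 : 0 ≤ γ := Real.sqrt_nonneg _
  have hγ2 : γ ^ 2 = 1 - |β| ^ 2 := by rw [sq_abs]; exact Real.sq_sqrt (by linarith)
  have hγ1 : γ ≤ 1 := by nlinarith [sq_nonneg |β|]
  -- For |β| = sin α and γ = cos α, q is tan(α/2); the optimum has both eigenvalues of V equal to 1
  -- + q².
  obtain ⟨q, hq0, hq⟩ : ∃ q : ℝ, 0 ≤ q ∧ q ^ 2 = (1 - γ) / (1 + γ) :=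
    ⟨√((1 - γ) / (1 + γ)), Real.sqrt_nonneg _,
      Real.sq_sqrt (div_nonneg (by linarith) (by linarith))⟩
  have hval : 4 / (1 + γ) = 2 + 2 * q ^ 2 := by rw [hq]; field_simp; ring
  have hbq : |β| = (1 + γ) * q := by
    refine (pow_left_inj₀ (abs_nonneg β) (by positivity) two_ne_zero).1 ?_
    rw [mul_pow, hq]
    field_simp
    linarith
  have hγq : γ * (1 + q ^ 2) = 1 - q ^ 2 := by rw [hq]; field_simp; ring
  rw [hval]
  constructor
  · refine ⟨!![1 + q ^ 2 + 0, 0; 0, 1 + q ^ 2 - 0], ⟨0, 0, 1 + q ^ 2, 0, rfl, by simp, ?_, ?_⟩, ?_⟩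
    · nlinarith
    · rw [show 1 + q ^ 2 + 0 - 1 = q ^ 2 by ring, show 1 + q ^ 2 - 0 - 1 = q ^ 2 by ring,
        Real.sqrt_sq hq0, hbq]
      nlinarith
    · simp [Matrix.trace_fin_two]; ring
  · rintro _ ⟨V, ⟨x, y, z, r, rfl, hr, h1, h2⟩, rfl⟩
    have hr0 : 0 ≤ r := hr ▸ Real.sqrt_nonneg _
    obtain ⟨s, hs⟩ : ∃ s, s = √(z + r - 1) := ⟨_, rfl⟩
    obtain ⟨t, ht⟩ : ∃ t, t = √(z - r - 1) := ⟨_, rfl⟩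
    have hs2 : s ^ 2 = z + r - 1 := by rw [hs, Real.sq_sqrt (by linarith)]
    have ht2 : t ^ 2 = z - r - 1 := by rw [ht, Real.sq_sqrt (by linarith)]
    have hs0 : 0 ≤ s := hs ▸ Real.sqrt_nonneg _
    have ht0 : 0 ≤ t := ht ▸ Real.sqrt_nonneg _
    rw [← hs, ← ht, hbq] at h2
    have h3 : (Matrix.trace !![z + x, y; y, z - x] : ℝ) = 2 + (s ^ 2 + t ^ 2) := by
      rw [hs2, ht2]; simp [Matrix.trace_fin_two]; ring
    rw [h3]
    -- Replacing both roots by their mean a keeps the sum, does not decrease the product and does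
    -- not increase the trace. The constraint is increasing in a and tight at q.
    obtain ⟨a, ha⟩ : ∃ a, a = (s + t) / 2 := ⟨_, rfl⟩
    have ha0 : 0 ≤ a := by rw [ha]; positivity
    have hst : s * t ≤ a ^ 2 := by rw [ha]; nlinarith [sq_nonneg (s - t)]
    have hst2 : 2 * a ^ 2 ≤ s ^ 2 + t ^ 2 := by rw [ha]; nlinarith [sq_nonneg (s - t)]
    have hbq0 : 0 ≤ (1 + γ) * q := by positivity
    have h4 : (1 + γ) * q ≤ (1 + γ) * q * a ^ 2 + γ * (2 * a) := by
      have := mul_le_mul_of_nonneg_left hst hbq0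
      rw [ha] at this ⊢
      nlinarith
    have h5 : q ≤ a := by
      by_contra! h
      have hq1 : 0 < (1 + γ) * q := mul_pos (by linarith) (ha0.trans_lt h)
      have h6 : (1 + γ) * q * a ^ 2 < (1 + γ) * q * q ^ 2 :=
        mul_lt_mul_of_pos_left (pow_lt_pow_left₀ h ha0 two_ne_zero) hq1
      have h7 : γ * (2 * a) ≤ γ * (2 * q) := mul_le_mul_of_nonneg_left (by linarith) hγ0
      have h8 : (1 + γ) * q * q ^ 2 = q * (1 - γ) := by linear_combination q * hγq
      linarith
    have h7 : q ^ 2 ≤ a ^ 2 := by gcongr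
    linarith

end PlaneGeometry

/-! ### From estimation vectors to the plane problem -/

section Attainable

variable {H : Type*} [NormedAddCommGroup H] [InnerProductSpace ℂ H]

/-- `V` dominates the Gram matrix of vectors `x` that are orthogonal to `φ` and real-biorthogonal
to the horizontal lifts `l`. -/
def IsAttainable (φ : H) (l : Fin 2 → H) (V : Matrix (Fin 2) (Fin 2) ℝ) : Prop :=
  V 1 0 = V 0 1 ∧ ∃ x : Fin 2 → H, (∀ j, ⟪φ, x j⟫_ℂ = 0) ∧
    (∀ i j, (⟪l i, x j⟫_ℂ).re = if i = j then 1 else 0) ∧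
    ∀ c : Fin 2 → ℂ, ‖∑ j, c j • x j‖ ^ 2 ≤ hermForm V c

theorem PureStateModel.mem_covSet_iff [CompleteSpace H] (𝓜 : PureStateModel H 2) {θ : Fin 2 → ℝ}
    (hθ : θ ∈ 𝓜.Θ) {V : Matrix (Fin 2) (Fin 2) ℝ} :
    V ∈ 𝓜.covSet θ ↔ IsAttainable (𝓜.φ θ) (horizontalLift 𝓜.φ θ) V := by
  constructor
  · rintro ⟨M, hM, rfl⟩
    exact ⟨(𝓜.isSymm_cov M).apply 0 1, 𝓜.exists_estimationVectors hθ hM⟩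
  · rintro ⟨hV, x, h1, h2, h3⟩
    exact 𝓜.mem_covSet_of_estimationVectors hθ hV h1 h2 h3

/-- Under θ' = Aθ the lifts transform contragrediently and the vectors x by A, so biorthogonality is
preserved. -/
theorem IsAttainable.change {φ : H} {l l' : Fin 2 → H} {V A B : Matrix (Fin 2) (Fin 2) ℝ}
    (hAB : A * B = 1) (hl : ∀ a, l' a = ∑ i, (B i a : ℂ) • l i) (h : IsAttainable φ l V) :
    IsAttainable φ l' (A * V * Aᵀ) := by
  obtain ⟨hV, x, h1, h2, h3⟩ := h
  refine ⟨?_, fun a => ∑ j, (A a j : ℂ) • x j, ?_, ?_, ?_⟩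
  · simp only [Matrix.mul_apply, Fin.sum_univ_two, Matrix.transpose_apply, hV]
    ring
  · intro a
    simp only [inner_sum, inner_smul_right, h1, mul_zero, Finset.sum_const_zero]
  · intro b a
    have h4 : (⟪l' b, ∑ j, (A a j : ℂ) • x j⟫_ℂ).re = (A * B) a b := by
      rw [hl, Matrix.mul_apply]
      simp only [Fin.sum_univ_two, inner_add_left, inner_add_right, inner_smul_left,
        inner_smul_right, Complex.conj_ofReal, Complex.add_re, Complex.re_ofReal_mul, h2]
      simp
    rw [h4, hAB, Matrix.one_apply]
    simp only [eq_comm]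
  · intro c
    have h4 : ∑ a, c a • ∑ j, (A a j : ℂ) • x j = ∑ j, (∑ a, c a * A a j) • x j := by
      simp only [Finset.smul_sum, Finset.sum_smul, mul_smul]
      exact Finset.sum_comm
    rw [h4]
    refine (h3 _).trans_eq ?_
    simp only [hermForm, Fin.sum_univ_two, Matrix.mul_apply, Matrix.transpose_apply, map_add,
      map_mul, Complex.conj_ofReal, Complex.mul_re, Complex.add_re, Complex.add_im, Complex.mul_im,
      Complex.conj_re, Complex.conj_im, Complex.ofReal_re, Complex.ofReal_im]
    ring

theorem hermForm_nonneg_iff {D0 D1 D2 s : ℝ} :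
    (∀ c d : ℂ, 0 ≤ D0 * ‖c‖ ^ 2 + D2 * ‖d‖ ^ 2
      + 2 * ((starRingEnd ℂ) c * d * ((D1 : ℂ) - s * Complex.I)).re) ↔
      0 ≤ D0 ∧ 0 ≤ D2 ∧ D1 ^ 2 + s ^ 2 ≤ D0 * D2 := by
  have hz : ∀ c d : ℂ, ((starRingEnd ℂ) c * d * ((D1 : ℂ) - s * Complex.I)).re
      = (c.re * d.re + c.im * d.im) * D1 + (c.re * d.im - c.im * d.re) * s := by
    intro c d
    simp only [Complex.mul_re, Complex.mul_im, Complex.sub_re, Complex.sub_im, Complex.conj_re,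
      Complex.conj_im, Complex.ofReal_re, Complex.ofReal_im, Complex.I_re, Complex.I_im]
    ring
  simp only [hz, ← Complex.normSq_eq_norm_sq, Complex.normSq_apply]
  constructor
  · intro h
    have h0 : 0 ≤ D0 := by simpa using h 1 0
    have h2 : 0 ≤ D2 := by simpa using h 0 1
    refine ⟨h0, h2, ?_⟩
    set N := D1 ^ 2 + s ^ 2 with hN
    have hN0 : 0 ≤ N := by positivity
    have key : ∀ t : ℝ, 0 ≤ D0 * N * (t * t) + (-2 * N) * t + D2 := by
      intro t
      -- This direction aligns the phase of the cross term, making it -2(D1² + s²)t.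
      have := h ⟨-D1 * t, s * t⟩ 1
      simp at this
      rw [hN]
      nlinarith
    have hd := discrim_le_zero key
    rw [discrim] at hd
    rcases hN0.eq_or_lt with h | h
    · rw [← h]; positivity
    · nlinarith
  · rintro ⟨h0, h2, h1⟩ c d
    set X := c.re * c.re + c.im * c.im with hX
    set Y := d.re * d.re + d.im * d.im with hY
    set Q := (c.re * d.re + c.im * d.im) * D1 + (c.re * d.im - c.im * d.re) * s with hQ
    have hX0 : 0 ≤ X := by nlinarith [sq_nonneg c.re, sq_nonneg c.im]
    have hY0 : 0 ≤ Y := by nlinarith [sq_nonneg d.re, sq_nonneg d.im]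
    have hXY : X * Y = (c.re * d.re + c.im * d.im) ^ 2 + (c.re * d.im - c.im * d.re) ^ 2 := by
      rw [hX, hY]; ring
    have hQ2 : Q ^ 2 ≤ (X * Y) * (D1 ^ 2 + s ^ 2) := by
      rw [hXY, hQ]
      nlinarith [sq_nonneg ((c.re * d.re + c.im * d.im) * s - (c.re * d.im - c.im * d.re) * D1)]
    have hQ3 : (X * Y) * (D1 ^ 2 + s ^ 2) ≤ (X * Y) * (D0 * D2) :=
      mul_le_mul_of_nonneg_left h1 (by positivity)
    have hsum : 0 ≤ D0 * X + D2 * Y := by positivity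
    have h3 : (2 * Q) ^ 2 ≤ (D0 * X + D2 * Y) ^ 2 := by
      nlinarith [sq_nonneg (D0 * X - D2 * Y)]
    have h4 := (abs_le.1 (abs_le_of_sq_le_sq h3 hsum)).1
    linarith

/-- The Gram form of two vectors with coordinates `α`, `η` in an orthonormal pair. -/
theorem norm_sq_add_norm_sq_coords (b γ p0 p1 p2 p3 : ℝ) (hγ : γ ^ 2 = 1 - b ^ 2) (c d : ℂ) :
    ‖c * (⟨1, γ * p0⟩ : ℂ) + d * (⟨0, γ * p2 + b⟩ : ℂ)‖ ^ 2
      + ‖c * (⟨-(b * p0), p1⟩ : ℂ) + d * (⟨γ - b * p2, p3⟩ : ℂ)‖ ^ 2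
      = (1 + p0 ^ 2 + p1 ^ 2) * ‖c‖ ^ 2 + (1 + p2 ^ 2 + p3 ^ 2) * ‖d‖ ^ 2
        + 2 * ((starRingEnd ℂ) c * d * (((p0 * p2 + p1 * p3 : ℝ) : ℂ)
          + ((γ * (p2 - p1) + b * (1 - (p0 * p3 - p1 * p2)) : ℝ) : ℂ) * Complex.I)).re := by
  simp only [← Complex.normSq_eq_norm_sq, Complex.normSq_apply, Complex.add_re, Complex.add_im,
    Complex.mul_re, Complex.mul_im, Complex.conj_re, Complex.conj_im, Complex.ofReal_re,
    Complex.ofReal_im, Complex.I_re, Complex.I_im]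
  linear_combination (p0 ^ 2 * (c.re * c.re + c.im * c.im)
    + (p2 ^ 2 + 1) * (d.re * d.re + d.im * d.im)
    + 2 * (p0 * p2) * (c.re * d.re + c.im * d.im)) * hγ

/-- Projecting x onto the plane of l_0 and e preserves the constraints and only lowers the Gram
form. The solutions of the constraints there are parametrized by P, and domination becomes
positivity of a 2×2 Hermitian form. -/
theorem isAttainable_iff_planeDominates {φ : H} {l : Fin 2 → H} {b : ℝ} (hb : b ^ 2 ≤ 1)
    (hφ : ∀ i, ⟪φ, l i⟫_ℂ = 0) (h00 : ⟪l 0, l 0⟫_ℂ = 1) (h11 : ⟪l 1, l 1⟫_ℂ = 1)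
    (h01 : ⟪l 0, l 1⟫_ℂ = b * Complex.I) {V : Matrix (Fin 2) (Fin 2) ℝ} :
    IsAttainable φ l V ↔
      V 1 0 = V 0 1 ∧ PlaneDominates b (V 0 0 - 1) (V 0 1) (V 1 1 - 1) := by
  set γ := √(1 - b ^ 2) with hγ
  have hγ2 : γ ^ 2 = 1 - b ^ 2 := Real.sq_sqrt (by linarith)
  have h10 : ⟪l 1, l 0⟫_ℂ = -(b * Complex.I) := by
    rw [← inner_conj_symm, h01]; simp
  -- If γ = 0 then γ⁻¹ = 0 and e = 0; no second direction is needed, and ‖e‖ ≤ 1 still holds.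
  obtain ⟨e, he⟩ : ∃ e : H, e = (γ : ℂ)⁻¹ • (l 1 - (b * Complex.I) • l 0) := ⟨_, rfl⟩
  have hdiff0 : ⟪l 0, l 1 - (b * Complex.I) • l 0⟫_ℂ = 0 := by
    rw [inner_sub_right, inner_smul_right, h01, h00]; simp
  have hdiff1 : ⟪l 1 - (b * Complex.I) • l 0, l 1 - (b * Complex.I) • l 0⟫_ℂ = (γ : ℂ) ^ 2 := by
    rw [inner_sub_left, inner_smul_left, hdiff0, inner_sub_right, inner_smul_right, h11, h10,
      mul_zero, sub_zero]
    have h1 : (γ : ℂ) ^ 2 = 1 - (b : ℂ) ^ 2 := by exact_mod_cast hγ2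
    rw [h1]
    linear_combination (b : ℂ) ^ 2 * Complex.I_sq
  have hl1 : l 1 = (b * Complex.I) • l 0 + (γ : ℂ) • e := by
    rcases eq_or_ne γ 0 with h | h
    · have h1 : l 1 - (b * Complex.I) • l 0 = 0 := by
        rw [← inner_self_eq_zero (𝕜 := ℂ), hdiff1, h]; simp
      rw [h, Complex.ofReal_zero, zero_smul, add_zero]
      exact sub_eq_zero.1 h1
    · rw [he, smul_inv_smul₀ (by exact_mod_cast h)]; abel
  have h0e : ⟪l 0, e⟫_ℂ = 0 := by rw [he, inner_smul_right, hdiff0, mul_zero]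
  have he0 : ⟪e, l 0⟫_ℂ = 0 := by rw [← inner_conj_symm, h0e, map_zero]
  have hφe : ⟪φ, e⟫_ℂ = 0 := by
    rw [he, inner_smul_right, inner_sub_right, inner_smul_right, hφ, hφ]; simp
  have hγe : (γ : ℂ) * ⟪e, e⟫_ℂ = γ := by
    rw [he, inner_smul_left, inner_smul_right, hdiff1]
    rcases eq_or_ne γ 0 with h | h
    · simp [h]
    · have hC : (γ : ℂ) ≠ 0 := by exact_mod_cast h
      rw [map_inv₀, Complex.conj_ofReal]
      field_simp
  have hee : ‖e‖ ^ 2 ≤ 1 := by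
    have h1 : ⟪e, e⟫_ℂ = ((‖e‖ ^ 2 : ℝ) : ℂ) := by
      rw [inner_self_eq_norm_sq_to_K]; push_cast; rfl
    rw [h1] at hγe
    have h2 : γ * ‖e‖ ^ 2 = γ := by exact_mod_cast hγe
    rcases eq_or_ne γ 0 with h | h
    · rw [he, h]; simp
    · exact (mul_right_eq_self₀.1 h2).elim (fun h => h.le) (fun h' => absurd h' h)
  have hl0 : ‖l 0‖ ^ 2 = 1 := by
    have h1 : (⟪l 0, l 0⟫_ℂ).re = ‖l 0‖ ^ 2 := inner_self_eq_norm_sq (𝕜 := ℂ) (l 0)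
    rw [← h1, h00, Complex.one_re]
  have hcontr : ∀ p q : ℂ, ‖p • l 0 + q • e‖ ^ 2 ≤ ‖p‖ ^ 2 + ‖q‖ ^ 2 := by
    intro p q
    have h1 : ⟪p • l 0, q • e⟫_ℂ = 0 := by
      rw [inner_smul_left, inner_smul_right, h0e]; simp
    have h2 := norm_add_sq_eq_norm_sq_add_norm_sq_of_inner_eq_zero _ _ h1
    rw [sq, h2, norm_smul, norm_smul]
    nlinarith [mul_le_mul_of_nonneg_left hee (sq_nonneg ‖q‖)]
  have hinner1 : ∀ y : H, (⟪l 1, y⟫_ℂ).re = b * (⟪l 0, y⟫_ℂ).im + γ * (⟪e, y⟫_ℂ).re := by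
    intro y
    rw [hl1, inner_add_left, inner_smul_left, inner_smul_left]
    simp
  have hform : ∀ (hV : V 1 0 = V 0 1) (p0 p1 p2 p3 : ℝ) (c : Fin 2 → ℂ),
      hermForm V c - (‖c 0 * (⟨1, γ * p0⟩ : ℂ) + c 1 * (⟨0, γ * p2 + b⟩ : ℂ)‖ ^ 2
        + ‖c 0 * (⟨-(b * p0), p1⟩ : ℂ) + c 1 * (⟨γ - b * p2, p3⟩ : ℂ)‖ ^ 2)
      = (V 0 0 - 1 - p0 ^ 2 - p1 ^ 2) * ‖c 0‖ ^ 2 + (V 1 1 - 1 - p2 ^ 2 - p3 ^ 2) * ‖c 1‖ ^ 2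
        + 2 * ((starRingEnd ℂ) (c 0) * c 1 * (((V 0 1 - p0 * p2 - p1 * p3 : ℝ) : ℂ)
          - ((γ * (p2 - p1) + b * (1 - (p0 * p3 - p1 * p2)) : ℝ) : ℂ) * Complex.I)).re := by
    intro hV p0 p1 p2 p3 c
    rw [norm_sq_add_norm_sq_coords b γ p0 p1 p2 p3 hγ2, hermForm_fin_two V hV]
    simp only [Complex.add_re, Complex.sub_re, Complex.add_im, Complex.sub_im,
      Complex.mul_re, Complex.mul_im, Complex.conj_re, Complex.conj_im, Complex.ofReal_re,
      Complex.ofReal_im, Complex.I_re, Complex.I_im]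
    ring
  constructor
  · rintro ⟨hV, x, -, hx, hxV⟩
    refine ⟨hV, ?_⟩
    have r00 := hx 0 0
    have r01 := hx 0 1
    have r10 := hx 1 0
    have r11 := hx 1 1
    rw [hinner1] at r10 r11
    simp only [if_true, if_false, one_ne_zero, zero_ne_one] at r00 r01 r10 r11
    -- The constraint b Im⟨l_0|x_0⟩ + γ Re⟨e|x_0⟩ = 0 puts the pair on the line spanned by (γ, -b).
    -- For x_1 the right side is 1 and the line is shifted by (b, γ).
    obtain ⟨p0, hp0⟩ : ∃ p0, (⟪l 0, x 0⟫_ℂ).im = γ * p0 ∧ (⟪e, x 0⟫_ℂ).re = -(b * p0) := by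
      rcases eq_or_ne γ 0 with h | h
      · rw [h] at r10 hγ2
        have hb0 : b ≠ 0 := by rintro rfl; norm_num at hγ2
        have h1 : (⟪l 0, x 0⟫_ℂ).im = 0 := by simpa [hb0] using r10
        exact ⟨0, by simp [h1], by simp [he, h]⟩
      · refine ⟨(⟪l 0, x 0⟫_ℂ).im / γ, (mul_div_cancel₀ _ h).symm, ?_⟩
        field_simp
        linarith
    obtain ⟨p2, hp2⟩ : ∃ p2, (⟪l 0, x 1⟫_ℂ).im = γ * p2 + b ∧ (⟪e, x 1⟫_ℂ).re = γ - b * p2 := by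
      rcases eq_or_ne γ 0 with h | h
      · rw [h] at r11 hγ2
        refine ⟨0, ?_, by simp [he, h]⟩
        linear_combination b * r11 - (⟪l 0, x 1⟫_ℂ).im * hγ2
      · refine ⟨((⟪l 0, x 1⟫_ℂ).im - b) / γ, by rw [mul_div_cancel₀ _ h]; ring, ?_⟩
        field_simp
        linear_combination r11 - hγ2
    refine ⟨p0, (⟪e, x 0⟫_ℂ).im, p2, (⟪e, x 1⟫_ℂ).im, hermForm_nonneg_iff.1 fun c d => ?_⟩
    have hf := hform hV p0 (⟪e, x 0⟫_ℂ).im p2 (⟪e, x 1⟫_ℂ).im ![c, d]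
    simp only [Matrix.cons_val_zero, Matrix.cons_val_one] at hf
    rw [← hf, sub_nonneg]
    refine le_trans ?_ (hxV ![c, d])
    have hc : IsContractive ![l 0, e] := by
      intro c
      simpa [Fin.sum_univ_two] using hcontr (c 0) (c 1)
    have h1 := hc.sum_norm_inner_sq_le (∑ j, (![c, d] : Fin 2 → ℂ) j • x j)
    simp only [Fin.sum_univ_two, Matrix.cons_val_zero, Matrix.cons_val_one, inner_add_right,
      inner_smul_right] at h1 ⊢
    have e00 : ⟪l 0, x 0⟫_ℂ = ⟨1, γ * p0⟩ := Complex.ext r00 hp0.1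
    have e01 : ⟪l 0, x 1⟫_ℂ = ⟨0, γ * p2 + b⟩ := Complex.ext r01 hp2.1
    have e10 : ⟪e, x 0⟫_ℂ = ⟨-(b * p0), (⟪e, x 0⟫_ℂ).im⟩ := Complex.ext hp0.2 rfl
    have e11 : ⟪e, x 1⟫_ℂ = ⟨γ - b * p2, (⟪e, x 1⟫_ℂ).im⟩ := Complex.ext hp2.2 rfl
    rwa [e00, e01, e10, e11] at h1
  · rintro ⟨hV, p0, p1, p2, p3, hD⟩
    have hpos := hermForm_nonneg_iff.2 hD
    refine ⟨hV, ![(⟨1, γ * p0⟩ : ℂ) • l 0 + (⟨-(b * p0), p1⟩ : ℂ) • e,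
      (⟨0, γ * p2 + b⟩ : ℂ) • l 0 + (⟨γ - b * p2, p3⟩ : ℂ) • e], ?_, ?_, ?_⟩
    · intro j
      fin_cases j <;> simp only [Fin.zero_eta, Fin.mk_one, Matrix.cons_val_zero, Matrix.cons_val_one,
        inner_add_right, inner_smul_right, hφ, hφe, mul_zero, add_zero]
    · have hl0x : ∀ p q : ℂ, ⟪l 0, p • l 0 + q • e⟫_ℂ = p := by
        intro p q
        rw [inner_add_right, inner_smul_right, inner_smul_right, h00, h0e]; simp
      have hl1x : ∀ p q : ℂ, (⟪l 1, p • l 0 + q • e⟫_ℂ).re = b * p.im + γ * q.re := by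
        intro p q
        rw [hl1, inner_add_left, inner_smul_left, inner_smul_left, hl0x, inner_add_right,
          inner_smul_right, inner_smul_right, he0, mul_zero, zero_add, Complex.conj_ofReal,
          mul_left_comm, hγe, Complex.add_re, Complex.re_mul_ofReal]
        simp [mul_comm]
      intro i j
      fin_cases i <;> fin_cases j
      · exact (congrArg Complex.re (hl0x _ _)).trans (by simp)
      · exact (congrArg Complex.re (hl0x _ _)).trans (by simp)
      · exact (hl1x _ _).trans (by simp; ring)
      · exact (hl1x _ _).trans (by simp; linarith)
    · intro c
      have h1 := hpos (c 0) (c 1)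
      rw [← hform hV p0 p1 p2 p3 c, sub_nonneg] at h1
      refine le_trans ?_ h1
      have h2 := hcontr (c 0 * (⟨1, γ * p0⟩ : ℂ) + c 1 * (⟨0, γ * p2 + b⟩ : ℂ))
        (c 0 * (⟨-(b * p0), p1⟩ : ℂ) + c 1 * (⟨γ - b * p2, p3⟩ : ℂ))
      refine le_of_eq_of_le ?_ h2
      congr 2
      simp only [Fin.sum_univ_two, Matrix.cons_val_zero, Matrix.cons_val_one]
      module

end Attainable

/-! ### Eigenvalues, normalizing coordinates and the conclusion -/

section Assembly

/-- For J symmetric and K antisymmetric, J⁻¹K has trace zero and determinant det K / det J = K₀₁² /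
det J. -/
theorem spectrum_inv_mul_antisymm {J K : Matrix (Fin 2) (Fin 2) ℝ} (hJ : J 1 0 = J 0 1)
    (hK0 : K 0 0 = 0) (hK1 : K 1 1 = 0) (hK : K 1 0 = -K 0 1) (hdet : J.det ≠ 0) :
    spectrum ℂ ((J⁻¹ * K).map (algebraMap ℝ ℂ))
      = {μ : ℂ | μ ^ 2 + ((K 0 1 ^ 2 / J.det : ℝ) : ℂ) = 0} := by
  ext μ
  have hinv : J⁻¹ = J.det⁻¹ • !![J 1 1, -J 0 1; -J 1 0, J 0 0] := by
    rw [Matrix.inv_def, Matrix.adjugate_fin_two, Ring.inverse_eq_inv']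
  have hD : J.det = J 0 0 * J 1 1 - J 0 1 ^ 2 := by rw [Matrix.det_fin_two, hJ]; ring
  have hDC : (J.det : ℂ) ≠ 0 := by exact_mod_cast hdet
  have hDC' : (J.det : ℂ) = J 0 0 * J 1 1 - (J 0 1 : ℂ) ^ 2 := by exact_mod_cast hD
  rw [spectrum.mem_iff, Matrix.isUnit_iff_isUnit_det, isUnit_iff_ne_zero, not_not,
    Matrix.det_fin_two, Set.mem_ofPred_eq, hinv]
  simp only [Matrix.sub_apply, Matrix.algebraMap_matrix_apply, Matrix.map_apply, Matrix.mul_apply,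
    Fin.sum_univ_two, Matrix.smul_apply, Matrix.of_apply, Matrix.cons_val_zero,
    Matrix.cons_val_one, Matrix.cons_val', Matrix.cons_val_fin_one, hK0, hK1, hK, hJ, smul_eq_mul,
    if_true, one_ne_zero, zero_ne_one, if_false, Complex.coe_algebraMap, Algebra.algebraMap_self,
    RingHom.id_apply]
  push_cast
  have h1 : (μ - ((J.det : ℂ)⁻¹ * (J 1 1 : ℂ) * 0 + (J.det : ℂ)⁻¹ * -(J 0 1 : ℂ) * -(K 0 1 : ℂ)))
      * (μ - ((J.det : ℂ)⁻¹ * -(J 0 1 : ℂ) * (K 0 1 : ℂ) + (J.det : ℂ)⁻¹ * (J 0 0 : ℂ) * 0))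
      - (0 - ((J.det : ℂ)⁻¹ * (J 1 1 : ℂ) * (K 0 1 : ℂ) + (J.det : ℂ)⁻¹ * -(J 0 1 : ℂ) * 0))
      * (0 - ((J.det : ℂ)⁻¹ * -(J 0 1 : ℂ) * 0 + (J.det : ℂ)⁻¹ * (J 0 0 : ℂ) * -(K 0 1 : ℂ)))
      = μ ^ 2 + (K 0 1 : ℂ) ^ 2 / (J.det : ℂ) := by
    field_simp
    rw [hDC']
    ring
  rw [h1]

variable {H : Type*} [NormedAddCommGroup H] [InnerProductSpace ℂ H]

namespace PureStateModel

variable (𝓜 : PureStateModel H 2) {θ : Fin 2 → ℝ}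

theorem sldFisher_symm (i j : Fin 2) : 𝓜.sldFisher θ i j = 𝓜.sldFisher θ j i := by
  simp only [sldFisher, Matrix.of_apply]
  rw [← inner_conj_symm, Complex.conj_re]

theorem imFisher_antisymm (i j : Fin 2) : 𝓜.imFisher θ i j = -𝓜.imFisher θ j i := by
  simp only [imFisher, Matrix.of_apply]
  rw [← inner_conj_symm, Complex.conj_im]

theorem inner_lifts (i j : Fin 2) :
    ⟪horizontalLift 𝓜.φ θ i, horizontalLift 𝓜.φ θ j⟫_ℂ
      = 𝓜.sldFisher θ i j + 𝓜.imFisher θ i j * Complex.I :=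
  (Complex.re_add_im _).symm

theorem sldFisher_quadratic_pos (hθ : θ ∈ 𝓜.Θ) {r s : ℝ} (h : r ≠ 0 ∨ s ≠ 0) :
    0 < 𝓜.sldFisher θ 0 0 * r ^ 2 + 𝓜.sldFisher θ 1 1 * s ^ 2
      + 2 * 𝓜.sldFisher θ 0 1 * (r * s) := by
  have hli := 𝓜.linearIndependent θ hθ
  rw [Fintype.linearIndependent_iff] at hli
  set l := horizontalLift 𝓜.φ θ
  have hne : (r : ℂ) • l 0 + (s : ℂ) • l 1 ≠ 0 := by
    intro h0
    have h1 := hli ![r, s] (by simpa [Fin.sum_univ_two, Complex.coe_smul] using h0)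
    exact h.elim (fun h => h (h1 0)) (fun h => h (h1 1))
  have h1 : (⟪(r : ℂ) • l 0 + (s : ℂ) • l 1, (r : ℂ) • l 0 + (s : ℂ) • l 1⟫_ℂ).re
      = 𝓜.sldFisher θ 0 0 * r ^ 2 + 𝓜.sldFisher θ 1 1 * s ^ 2
        + 2 * 𝓜.sldFisher θ 0 1 * (r * s) := by
    simp only [inner_add_left, inner_add_right, inner_smul_left, inner_smul_right,
      Complex.conj_ofReal, Complex.add_re, Complex.re_ofReal_mul]
    have h2 := 𝓜.sldFisher_symm (θ := θ) 1 0
    simp only [sldFisher, Matrix.of_apply] at h2 ⊢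
    rw [h2]
    ring
  rw [← h1]
  have h3 : (⟪(r : ℂ) • l 0 + (s : ℂ) • l 1, (r : ℂ) • l 0 + (s : ℂ) • l 1⟫_ℂ).re
      = ‖(r : ℂ) • l 0 + (s : ℂ) • l 1‖ ^ 2 := inner_self_eq_norm_sq (𝕜 := ℂ) _
  rw [h3]
  have := norm_pos_iff.2 hne
  positivity

theorem det_sldFisher_pos (hθ : θ ∈ 𝓜.Θ) :
    0 < 𝓜.sldFisher θ 0 0 ∧ 0 < (𝓜.sldFisher θ).det := by
  have h0 : 0 < 𝓜.sldFisher θ 0 0 := by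
    simpa using 𝓜.sldFisher_quadratic_pos hθ (r := 1) (s := 0) (by simp)
  refine ⟨h0, ?_⟩
  have h1 := 𝓜.sldFisher_quadratic_pos hθ (r := -𝓜.sldFisher θ 0 1) (s := 𝓜.sldFisher θ 0 0)
    (Or.inr h0.ne')
  rw [Matrix.det_fin_two, 𝓜.sldFisher_symm 1 0]
  have h2 : 0 < 𝓜.sldFisher θ 0 0 * (𝓜.sldFisher θ 0 0 * 𝓜.sldFisher θ 1 1
      - 𝓜.sldFisher θ 0 1 * 𝓜.sldFisher θ 0 1) := by
    refine h1.trans_eq ?_; ring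
  exact pos_of_mul_pos_right h2 h0.le

/-- Cholesky factor of J^S; it supplies normalizing coordinates for the trace bound, whose statement
mentions none. -/
theorem exists_transpose_mul_self (hθ : θ ∈ 𝓜.Θ) :
    ∃ A : Matrix (Fin 2) (Fin 2) ℝ, A.transpose * A = 𝓜.sldFisher θ := by
  obtain ⟨h0, hdet⟩ := 𝓜.det_sldFisher_pos hθ
  rw [Matrix.det_fin_two, 𝓜.sldFisher_symm 1 0] at hdet
  obtain ⟨a, ha, ha2⟩ : ∃ a : ℝ, 0 < a ∧ a ^ 2 = 𝓜.sldFisher θ 0 0 :=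
    ⟨√(𝓜.sldFisher θ 0 0), Real.sqrt_pos.2 h0, Real.sq_sqrt h0.le⟩
  obtain ⟨e, he⟩ : ∃ e : ℝ, a * e = 𝓜.sldFisher θ 0 1 :=
    ⟨𝓜.sldFisher θ 0 1 / a, mul_div_cancel₀ _ ha.ne'⟩
  obtain ⟨f, hf⟩ : ∃ f : ℝ, f ^ 2 = 𝓜.sldFisher θ 1 1 - e ^ 2 := by
    refine ⟨√(𝓜.sldFisher θ 1 1 - e ^ 2), Real.sq_sqrt ?_⟩
    rw [← ha2, ← he] at hdet
    have h2 : 0 < a ^ 2 * (𝓜.sldFisher θ 1 1 - e ^ 2) := by refine hdet.trans_eq ?_; ring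
    exact (pos_of_mul_pos_right h2 (by positivity)).le
  refine ⟨!![a, e; 0, f], ?_⟩
  ext i j
  fin_cases i <;> fin_cases j <;> simp [Matrix.mul_apply, Fin.sum_univ_two]
  · rw [← ha2]; ring
  · exact he
  · rw [𝓜.sldFisher_symm 1 0, ← he]; ring
  · linear_combination hf

theorem hasEigenvaluesPM_iff (hθ : θ ∈ 𝓜.Θ) {β : ℝ} :
    𝓜.HasEigenvaluesPM θ β ↔ β ^ 2 = 𝓜.imFisher θ 0 1 ^ 2 / (𝓜.sldFisher θ).det := by
  have hd : ∀ i, 𝓜.imFisher θ i i = 0 := fun i => by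
    have := 𝓜.imFisher_antisymm (θ := θ) i i; linarith
  rw [HasEigenvaluesPM, spectrum_inv_mul_antisymm (𝓜.sldFisher_symm 1 0) (hd 0) (hd 1)
    (𝓜.imFisher_antisymm 1 0) (𝓜.det_sldFisher_pos hθ).2.ne']
  generalize 𝓜.imFisher θ 0 1 ^ 2 / (𝓜.sldFisher θ).det = D
  constructor
  · intro h
    have h1 : Complex.I * β ∈ ({Complex.I * β, -(Complex.I * β)} : Set ℂ) := by simp
    rw [← h, Set.mem_ofPred_eq, mul_pow, Complex.I_sq] at h1
    have h2 : ((D - β ^ 2 : ℝ) : ℂ) = 0 := by push_cast; linear_combination h1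
    have h3 : D - β ^ 2 = 0 := by exact_mod_cast h2
    linarith
  · rintro rfl
    ext μ
    have h1 : μ ^ 2 + ((β ^ 2 : ℝ) : ℂ) = (μ - Complex.I * β) * (μ + Complex.I * β) := by
      push_cast
      linear_combination (β : ℂ) ^ 2 * Complex.I_sq
    rw [Set.mem_ofPred_eq, h1, mul_eq_zero, sub_eq_zero, add_eq_zero_iff_eq_neg]
    rfl

/-- The set of covariance matrices in coordinates in which `J^S` is the identity. -/
theorem exists_covSetIn_eq [CompleteSpace H] (hθ : θ ∈ 𝓜.Θ) {A : Matrix (Fin 2) (Fin 2) ℝ}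
    (hA : A.transpose * A = 𝓜.sldFisher θ) :
    ∃ b : ℝ, b ^ 2 ≤ 1 ∧ b ^ 2 = 𝓜.imFisher θ 0 1 ^ 2 / (𝓜.sldFisher θ).det ∧
      𝓜.covSetIn θ A = normalizedRegion b := by
  have hdet := (𝓜.det_sldFisher_pos hθ).2
  have hdet2 : A.det ^ 2 = (𝓜.sldFisher θ).det := by
    rw [← hA, Matrix.det_mul, Matrix.det_transpose, sq]
  have hA0 : A.det ≠ 0 := by
    intro h; rw [h] at hdet2; norm_num at hdet2; exact hdet.ne hdet2
  obtain ⟨B, hB⟩ : ∃ B, B = A⁻¹ := ⟨_, rfl⟩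
  have hAB : A * B = 1 := by rw [hB]; exact Matrix.mul_nonsing_inv _ (isUnit_iff_ne_zero.2 hA0)
  have hBA : B * A = 1 := by rw [hB]; exact Matrix.nonsing_inv_mul _ (isUnit_iff_ne_zero.2 hA0)
  set l := horizontalLift 𝓜.φ θ with hl
  obtain ⟨l', hl'⟩ : ∃ l' : Fin 2 → H, l' = fun a => ∑ i, (B i a : ℂ) • l i := ⟨_, rfl⟩
  have hinner : ∀ a c, ⟪l' a, l' c⟫_ℂ = ((Bᵀ * 𝓜.sldFisher θ * B) a c : ℝ)
      + ((Bᵀ * 𝓜.imFisher θ * B) a c : ℝ) * Complex.I := by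
    intro a c
    simp only [hl', hl, inner_add_left, inner_add_right, inner_smul_left, inner_smul_right,
      inner_lifts,
      Fin.sum_univ_two, Matrix.mul_apply, Matrix.transpose_apply, Complex.conj_ofReal]
    push_cast
    ring
  have hJ : Bᵀ * 𝓜.sldFisher θ * B = 1 := by
    rw [← hA, Matrix.mul_assoc, Matrix.mul_assoc, hAB, Matrix.mul_one, ← Matrix.transpose_mul, hAB,
      Matrix.transpose_one]
  have hd : ∀ i, 𝓜.imFisher θ i i = 0 := fun i => by
    have := 𝓜.imFisher_antisymm (θ := θ) i i; linarith
  -- An antisymmetric 2×2 form is multiplied by the determinant under a change of basis; this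
  -- identifies b, and Cauchy–Schwarz for the normalized lifts bounds it by 1.
  have hK : Bᵀ * 𝓜.imFisher θ * B
      = !![0, 𝓜.imFisher θ 0 1 * B.det; -(𝓜.imFisher θ 0 1 * B.det), 0] := by
    ext i j
    fin_cases i <;> fin_cases j <;>
      simp [Matrix.mul_apply, Fin.sum_univ_two, Matrix.det_fin_two, hd,
        𝓜.imFisher_antisymm (θ := θ) 1 0] <;> ring
  obtain ⟨b, hb⟩ : ∃ b, b = 𝓜.imFisher θ 0 1 * B.det := ⟨_, rfl⟩
  rw [hJ, hK, ← hb] at hinner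
  have h00 : ⟪l' 0, l' 0⟫_ℂ = 1 := by rw [hinner]; simp
  have h11 : ⟪l' 1, l' 1⟫_ℂ = 1 := by rw [hinner]; simp
  have h01 : ⟪l' 0, l' 1⟫_ℂ = b * Complex.I := by rw [hinner]; simp
  have hb1 : b ^ 2 ≤ 1 := by
    have hn : ∀ a, ⟪l' a, l' a⟫_ℂ = 1 → ‖l' a‖ = 1 := by
      intro a ha
      have h1 : (⟪l' a, l' a⟫_ℂ).re = ‖l' a‖ ^ 2 := inner_self_eq_norm_sq (𝕜 := ℂ) (l' a)
      rw [ha, Complex.one_re] at h1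
      exact (pow_eq_one_iff_of_nonneg (norm_nonneg _) two_ne_zero).1 h1.symm
    have h2 := norm_inner_le_norm (𝕜 := ℂ) (l' 0) (l' 1)
    rw [h01, hn 0 h00, hn 1 h11] at h2
    rw [sq_le_one_iff_abs_le_one]
    simpa using h2
  have hφl : ∀ i, ⟪𝓜.φ θ, l i⟫_ℂ = 0 := by
    intro i
    rw [← inner_conj_symm, 𝓜.inner_horizontalLift θ hθ i, map_zero]
  have hφl' : ∀ a, ⟪𝓜.φ θ, l' a⟫_ℂ = 0 := by
    intro a
    simp only [hl', inner_sum, inner_smul_right, hφl, mul_zero, Finset.sum_const_zero]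
  have hback : ∀ i, l i = ∑ a, (A a i : ℂ) • l' a := by
    intro i
    have h1 : ∑ a, (A a i : ℂ) • l' a = ∑ j, (((B * A) j i : ℝ) : ℂ) • l j := by
      simp only [hl', Matrix.mul_apply, Fin.sum_univ_two]
      push_cast
      module
    rw [h1, hBA]
    fin_cases i <;> simp [Matrix.one_apply]
  have hiff : ∀ W, IsAttainable (𝓜.φ θ) l' W ↔ W ∈ normalizedRegion b := by
    intro W
    rw [isAttainable_iff_planeDominates hb1 hφl' h00 h11 h01, planeDominates_iff hb1,
      mem_normalizedRegion_iff]
  refine ⟨b, hb1, ?_, ?_⟩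
  · have h1 : A.det * B.det = 1 := by rw [← Matrix.det_mul, hAB, Matrix.det_one]
    rw [← hdet2, hb, eq_div_iff (by positivity)]
    linear_combination (𝓜.imFisher θ 0 1 ^ 2 * (A.det * B.det + 1)) * h1
  · ext W
    rw [← hiff]
    constructor
    · rintro ⟨V, hV, rfl⟩
      exact ((𝓜.mem_covSet_iff hθ).1 hV).change hAB (fun a => by rw [hl'])
    · intro hW
      refine ⟨B * W * Bᵀ, (𝓜.mem_covSet_iff hθ).2 (hW.change hBA hback), ?_⟩
      change A * (B * W * Bᵀ) * Aᵀ = W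
      calc A * (B * W * Bᵀ) * Aᵀ = (A * B) * W * (Bᵀ * Aᵀ) := by simp only [Matrix.mul_assoc]
        _ = W := by rw [← Matrix.transpose_mul, hAB]; simp

theorem covSetIn_eq_normalizedRegion [CompleteSpace H] (hθ : θ ∈ 𝓜.Θ) {β : ℝ}
    (hβ : 𝓜.HasEigenvaluesPM θ β) {A : Matrix (Fin 2) (Fin 2) ℝ}
    (hA : A.transpose * A = 𝓜.sldFisher θ) :
    |β| ≤ 1 ∧ 𝓜.covSetIn θ A = normalizedRegion β := by
  obtain ⟨b, hb1, hb, h⟩ := 𝓜.exists_covSetIn_eq hθ hA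
  rw [← (𝓜.hasEigenvaluesPM_iff hθ).1 hβ] at hb
  exact ⟨(sq_le_one_iff_abs_le_one β).1 (hb ▸ hb1), h.trans (normalizedRegion_congr hb)⟩

theorem image_trace_covSet {A : Matrix (Fin 2) (Fin 2) ℝ}
    (hA : A.transpose * A = 𝓜.sldFisher θ) :
    (fun V => (𝓜.sldFisher θ * V).trace) '' 𝓜.covSet θ = Matrix.trace '' 𝓜.covSetIn θ A := by
  rw [covSetIn, Set.image_image]
  refine Set.image_congr fun V _ => ?_
  rw [← hA, Matrix.mul_assoc, Matrix.trace_mul_comm]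

end PureStateModel

end Assembly

end PureEstimation

theorem mainTheorem3 {H : Type*} [NormedAddCommGroup H] [InnerProductSpace ℂ H] [CompleteSpace H]
    (𝓜 : PureEstimation.PureStateModel H 2) (θ : Fin 2 → ℝ) (hθ : θ ∈ 𝓜.Θ) :
    (∃ β : ℝ, 𝓜.HasEigenvaluesPM θ β) ∧
    ∀ β : ℝ, 𝓜.HasEigenvaluesPM θ β →
      |β| ≤ 1 ∧
      (∀ A : Matrix (Fin 2) (Fin 2) ℝ, A.transpose * A = 𝓜.sldFisher θ →
        𝓜.covSetIn θ A = PureEstimation.normalizedRegion β) ∧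
      IsLeast ((fun V => (𝓜.sldFisher θ * V).trace) '' 𝓜.covSet θ)
        (4 / (1 + √(1 - β ^ 2))) ∧
      (∀ (H' : Type*) [NormedAddCommGroup H'] [InnerProductSpace ℂ H'] [CompleteSpace H']
        (𝓜' : PureEstimation.PureStateModel H' 2) (θ' : Fin 2 → ℝ), θ' ∈ 𝓜'.Θ →
        ∀ β' : ℝ, 𝓜'.HasEigenvaluesPM θ' β' → |β'| ≤ |β| →
        ∀ A A' : Matrix (Fin 2) (Fin 2) ℝ,
          A.transpose * A = 𝓜.sldFisher θ → A'.transpose * A' = 𝓜'.sldFisher θ' →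
          𝓜.covSetIn θ A ⊆ 𝓜'.covSetIn θ' A') := by
  have hd := (𝓜.det_sldFisher_pos hθ).2
  refine ⟨⟨√(𝓜.imFisher θ 0 1 ^ 2 / (𝓜.sldFisher θ).det), ?_⟩, ?_⟩
  · rw [𝓜.hasEigenvaluesPM_iff hθ, Real.sq_sqrt (by positivity)]
  · intro β hβ
    obtain ⟨A₀, hA₀⟩ := 𝓜.exists_transpose_mul_self hθ
    obtain ⟨hβ1, hreg⟩ := 𝓜.covSetIn_eq_normalizedRegion hθ hβ hA₀
    refine ⟨hβ1, fun A hA => (𝓜.covSetIn_eq_normalizedRegion hθ hβ hA).2, ?_, ?_⟩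
    · rw [𝓜.image_trace_covSet hA₀, hreg]
      exact PureEstimation.isLeast_trace_normalizedRegion hβ1
    · intro H' _ _ _ 𝓜' θ' hθ' β' hβ' hle A A' hA hA'
      rw [(𝓜.covSetIn_eq_normalizedRegion hθ hβ hA).2,
        (𝓜'.covSetIn_eq_normalizedRegion hθ' hβ' hA').2]
      exact PureEstimation.normalizedRegion_anti hle
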